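/- **Notation.** Let $\overline{\mathbb Q}$ be the algebraic closure of $\mathbb Q$ in $\mathbb C$, $\mathbb Q^{\rm ab}\subset\overline{\mathbb Q}$ the maximal abelian extension of $\mathbb Q$, $\mu_\infty\subset\mathbb C^\times$ the group of all roots of unity, $\hat{\mathbb Z}=\prod_p\mathbb Z_p$, and $\mathbb A=\mathbb A^{\rm f}\times\mathbb R$ the adèle ring of $\mathbb Q$ with its finite part $\mathbb A^{\rm f}$. Let $\mathbb N$ be the multiplicative monoid of positive integers, and $\mathbb Q_+$, $\mathbb R_+$ the multiplicative groups of positive rational and positive real numbers. *Rational Witt vectors.* For a commutative ring $R$, $W_{\rm rat}(R)$ is the group of fractions $f/g$ of polynomials $f,g\in R[t]$ with $f(0)=g(0)=1$. Its addition is the multiplication of fractions, its multiplication is the functorial biadditive operation with $(1-at)\odot(1-bt)=1-abt$. Put $[a]=1-at$ for $a\in R$, and for $n\in\mathbb N$ let $F_n$ be the functorial Frobenius endomorphism of the ring $W_{\rm rat}(R)$ with $F_n[a]=[a^n]$. *Deninger systems.* For a field $K\subset\overline{\mathbb Q}$ with ring of integers $\mathcal O_K$ put $$\dot X_K=\{(\mathfrak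 p,P)\mid \mathfrak p\in{\rm Spec}\,\mathcal O_K,\ P:W_{\rm rat}(\kappa(\mathfrak p))\to\mathbb C\ \text{a ring homomorphism}\},\qquad F_n(\mathfrak p,P)=(\mathfrak p,P\circ F_n).$$ For $K\subset L\subset\overline{\mathbb Q}$ there is the projection $\dot X_L\to\dot X_K$, $(\mathfrak P,P)\mapsto(\mathfrak P\cap K,P|_{W_{\rm rat}(\kappa(\mathfrak P\cap K))})$. The space $\dot X_{\overline{\mathbb Q}}$ has the topology of pointwise convergence of the multiplicative maps $\mathcal O_{\overline{\mathbb Q}}\to\mathbb C$, $a\mapsto P([a\bmod\mathfrak p])$, and $\dot X_K$ has the quotient topology with respect to $\dot X_{\overline{\mathbb Q}}\to\dot X_K$. Let $\check X_K=\varinjlim_{n\in\mathbb N}\dot X_K$ be the inductive limit over $\mathbb N$ ordered by divisibility, with transition maps $F_{m/n}$ for $n\mid m$ and with the inductive limit topology; on it the $F_n$ become invertible, so that $\mathbb Q_+$ acts. Let $\mathfrak X_K=\check X_K\times_{\mathbb Q_+}\mathbb R_+$ be the quotient of $\check X_K\times\mathbb R_+$ by the action $q\cdot(x,u)=(F_qx,q^{-1}u)$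 of $\mathbb Q_+$, with the quotient topology. It carries the flow $\phi^t[x,u]=[x,tu]$ $(t\in\mathbb R_+)$, the right action of ${\rm Gal}(K/\mathbb Q)$ (for $K/\mathbb Q$ Galois) induced by $(\mathfrak p,P)^\sigma=(\sigma^{-1}\mathfrak p,P\circ\sigma)$, and for $K\subset L$ the induced projection $\varpi_{L/K}:\mathfrak X_L\to\mathfrak X_K$. *Connes–Consani adelic spaces.* Let ${\rm cycl}:{\rm Gal}(\mathbb Q^{\rm ab}/\mathbb Q)\to\hat{\mathbb Z}^\times$ be the cyclotomic character, $\sigma(\zeta)=\zeta^{{\rm cycl}(\sigma)}$ for $\zeta\in\mu_\infty$. For a subextension $F$ of $\mathbb Q^{\rm ab}/\mathbb Q$ put $U_F={\rm cycl}({\rm Gal}(\mathbb Q^{\rm ab}/F))$ and $$\mathscr X_F=\mathbb Q^\times\backslash\mathbb A/U_F,\qquad\text{in particular}\quad \mathscr X_{\mathbb Q^{\rm ab}}=\mathbb Q^\times\backslash\mathbb A,$$ with the quotient topology, where $U_F\subset\hat{\mathbb Z}^\times$ acts by multiplication on the finite components. The group $\mathbb R_+$ acts on $\mathscr X_F$ by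 multiplication on the real component, and $g\in{\rm Gal}(F/\mathbb Q)$ acts by multiplication of the finite components by ${\rm cycl}(\tilde g)$, for any extension $\tilde g$ of $g$ to $\mathbb Q^{\rm ab}$. Let $\varphi_{\mathbb Q^{\rm ab}/F}:\mathscr X_{\mathbb Q^{\rm ab}}\to\mathscr X_F$ be the natural map. *The map $\Psi_{\mathbb Q^{\rm ab}}$.* Identify $\hat{\mathbb Z}$ with ${\rm Hom}(\mu_\infty,\mu_\infty)$ by $a\mapsto(\zeta\mapsto\zeta^a)$. Define $\psi:\dot X_{\mathbb Q^{\rm ab}}\to\hat{\mathbb Z}$ by sending $(\mathfrak P,P)$ to the character $\zeta\mapsto P([\zeta\bmod\mathfrak P])$ of $\mu_\infty$, i.e. to $P|_{\mu_\infty(\kappa(\mathfrak P))}\circ\iota_{\mathfrak P}$ with $\iota_{\mathfrak P}$ the reduction of roots of unity modulo $\mathfrak P$. Let $\check\psi:\check X_{\mathbb Q^{\rm ab}}\to\mathbb A^{\rm f}$ be its extension, $\check\psi(F_n^{-1}x)=n^{-1}\psi(x)$. Let $\mathbb A^{\rm f}\times_{\mathbb Q_+}\mathbb R_+$ be the quotient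 of $\mathbb A^{\rm f}\times\mathbb R_+$ by $q\cdot(a,u)=(qa,q^{-1}u)$, and $\tau:\mathbb A^{\rm f}\times_{\mathbb Q_+}\mathbb R_+\to\mathbb Q^\times\backslash\mathbb A$, $\tau[a,u]=[(a,u^{-1})]$. Then $$\Psi_{\mathbb Q^{\rm ab}}=\tau\circ(\check\psi\times_{\mathbb Q_+}{\rm id}_{\mathbb R_+}):\mathfrak X_{\mathbb Q^{\rm ab}}\to\mathscr X_{\mathbb Q^{\rm ab}},\qquad \Psi_{\mathbb Q^{\rm ab}}[x,u]=[(\check\psi(x),u^{-1})].$$ **Lemma 3.5.** The map $\Psi_{\mathbb Q^{\rm ab}}:\mathfrak X_{\mathbb Q^{\rm ab}}\to\mathscr X_{\mathbb Q^{\rm ab}}$ is continuous. It is $\mathbb R_+$-anti-equivariant, $\Psi_{\mathbb Q^{\rm ab}}(\phi^t x)=t^{-1}\cdot\Psi_{\mathbb Q^{\rm ab}}(x)$ for all $t\in\mathbb R_+$, and ${\rm Gal}(\mathbb Q^{\rm ab}/\mathbb Q)$-equivariant, $\Psi_{\mathbb Q^{\rm ab}}(x^\sigma)=\Psi_{\mathbb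 Q^{\rm ab}}(x)^\sigma$ for all $\sigma\in{\rm Gal}(\mathbb Q^{\rm ab}/\mathbb Q)$. For every subextension $F$ of $\mathbb Q^{\rm ab}/\mathbb Q$ of finite degree over $\mathbb Q$ there is a unique map $\Psi_F:\mathfrak X_F\to\mathscr X_F$ with $$\Psi_F\circ\varpi_{\mathbb Q^{\rm ab}/F}=\varphi_{\mathbb Q^{\rm ab}/F}\circ\Psi_{\mathbb Q^{\rm ab}},$$ and $\Psi_F$ is continuous, $\mathbb R_+$-anti-equivariant and ${\rm Gal}(F/\mathbb Q)$-equivariant. -/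

import Mathlib

open Polynomial

namespace RatWitt

/-- `∏ g(a)` over the "inverse roots" `a` of `p = ∏ (1 - a t)`, written as a resultant:
`g` is a polynomial in a variable `x` with coefficients in `R[t]`, and `p.reverse = ∏ (x - a)`. -/
noncomputable def rootProd {R : Type*} [CommRing R] (p : R[X]) (g : R[X][X]) : R[X] :=
  resultant (p.reverse.map C) g p.natDegree g.natDegree

lemma rootProd_eq {R : Type*} [CommRing R] (p : R[X]) (g : R[X][X]) (hp : p.coeff 0 = 1)
    (hg : g.coeff 0 = 1) (m n : ℕ) (hm : p.natDegree ≤ m) (hn : g.natDegree ≤ n) :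
    rootProd p g = resultant ((p.reflect m).map C) g m n := by
  nontriviality R
  have key : ∀ k, resultant ((p.reflect (p.natDegree + k)).map C) g (p.natDegree + k) g.natDegree
      = rootProd p g := by
    intro k
    induction k with
    | zero => rfl
    | succ k ih =>
      have h1 : p.reflect (p.natDegree + (k + 1)) = X * p.reflect (p.natDegree + k) := by
        have := reflect_mul (1 : R[X]) p (F := 1) (G := p.natDegree + k) (by simp) (by simp)
        rw [one_mul, reflect_one, pow_one] at this
        rw [← this]; congr 1; ring
      have hd : (p.reflect (p.natDegree + k)).natDegree = p.natDegree + k := by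
        apply natDegree_eq_of_le_of_coeff_ne_zero
        · rw [natDegree_le_iff_coeff_eq_zero]
          intro N hN
          rw [coeff_reflect, revAt_eq_self_of_lt hN]
          exact coeff_eq_zero_of_natDegree_lt (by omega)
        · rw [coeff_reflect, revAt_le le_rfl, Nat.sub_self, hp]; exact one_ne_zero
      have hd' : ((p.reflect (p.natDegree + k)).map (C : R →+* R[X])).natDegree
          = p.natDegree + k := by
        rw [natDegree_map_eq_of_injective C_injective, hd]
      have := resultant_mul_left (X : R[X][X]) ((p.reflect (p.natDegree + k)).map C) g
        g.natDegree le_rfl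
      rw [hd', natDegree_X, ih] at this
      rw [h1, Polynomial.map_mul, map_X, show p.natDegree + (k + 1) = 1 + (p.natDegree + k) by ring,
        this]
      have hX := resultant_X_sub_C_left g g.natDegree 0 le_rfl
      rw [C_0, sub_zero] at hX
      rw [hX, ← coeff_zero_eq_eval_zero, hg, one_mul]
  obtain ⟨k, rfl⟩ := Nat.exists_eq_add_of_le hm
  obtain ⟨l, rfl⟩ := Nat.exists_eq_add_of_le hn
  rw [resultant_add_right_deg _ _ _ _ _ le_rfl, key, coeff_map, coeff_reflect, revAt_le le_rfl,
    Nat.sub_self, hp]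
  simp

lemma rootProd_map {R S : Type*} [CommRing R] [CommRing S] (f : R →+* S) (p : R[X]) (g : R[X][X])
    (hp : p.coeff 0 = 1) (hg : g.coeff 0 = 1) :
    rootProd (p.map f) (g.map (mapRingHom f)) = (rootProd p g).map f := by
  rw [rootProd_eq (p.map f) (g.map (mapRingHom f)) (by simp [hp]) (by simp [hg]) p.natDegree
    g.natDegree natDegree_map_le natDegree_map_le, rootProd, ← coe_mapRingHom (f := f),
    ← resultant_map_map, reverse, coe_mapRingHom, reflect_map, Polynomial.map_map, Polynomial.map_map]
  congr 2
  ext x : 1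
  simp

lemma rootProd_one {R : Type*} [CommRing R] (g : R[X][X]) : rootProd (1 : R[X]) g = 1 := by
  rw [rootProd]; simp

lemma rootProd_mul_left {R : Type*} [CommRing R] (p q : R[X]) (g : R[X][X]) (hp : p.coeff 0 = 1)
    (hq : q.coeff 0 = 1) (hg : g.coeff 0 = 1) :
    rootProd (p * q) g = rootProd p g * rootProd q g := by
  nontriviality R
  have hd : ∀ p : R[X], p.coeff 0 = 1 → (p.reverse.map (C : R →+* R[X])).natDegree
      = p.natDegree := by
    intro p hp
    rw [natDegree_map_eq_of_injective C_injective, reverse_natDegree,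
      natTrailingDegree_eq_zero_of_constantCoeff_ne_zero (by simp [constantCoeff_apply, hp]),
      Nat.sub_zero]
  have hpq : (p * q).coeff 0 = 1 := by rw [mul_coeff_zero, hp, hq, mul_one]
  rw [rootProd_eq (p * q) g hpq hg (p.natDegree + q.natDegree) g.natDegree natDegree_mul_le le_rfl,
    reflect_mul p q le_rfl le_rfl, Polynomial.map_mul]
  have := resultant_mul_left (p.reverse.map C) (q.reverse.map C) g g.natDegree le_rfl
  rw [hd p hp, hd q hq] at this
  exact this

lemma rootProd_mul_right {R : Type*} [CommRing R] (p : R[X]) (g h : R[X][X]) (hp : p.coeff 0 = 1)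
    (hg : g.coeff 0 = 1) (hh : h.coeff 0 = 1) :
    rootProd p (g * h) = rootProd p g * rootProd p h := by
  have hpd : (p.reverse.map (C : R →+* R[X])).natDegree ≤ p.natDegree :=
    natDegree_map_le.trans (reverse_natDegree_le p)
  rw [rootProd_eq p (g * h) hp (by rw [mul_coeff_zero, hg, hh, mul_one]) p.natDegree
    (g.natDegree + h.natDegree) le_rfl natDegree_mul_le]
  exact resultant_mul_right _ g h _ hpd

lemma rootProd_linear {R : Type*} [CommRing R] (a : R) (g : R[X][X]) (hg : g.coeff 0 = 1) :
    rootProd (1 - C a * X) g = g.eval (C a) := by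
  rw [rootProd_eq _ g (by simp) hg 1 g.natDegree _ le_rfl]
  · have : reflect 1 (1 - C a * X : R[X]) = X - C a := by
      rw [reflect_sub, reflect_one, reflect_C_mul, reflect_one_X, pow_one, mul_one]
    rw [this, Polynomial.map_sub, map_X, map_C]
    exact resultant_X_sub_C_left _ _ _ le_rfl
  · refine (natDegree_sub_le _ _).trans ?_
    rw [natDegree_one]
    exact max_le (Nat.zero_le _) ((natDegree_C_mul_le _ _).trans natDegree_X_le)

lemma rootProd_coeff_zero {R : Type*} [CommRing R] (p : R[X]) (g : R[X][X]) (hp : p.coeff 0 = 1)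
    (hg : g.map constantCoeff = 1) : (rootProd p g).coeff 0 = 1 := by
  have h : constantCoeff (rootProd p g) = 1 := by
    rw [rootProd, ← resultant_map_map, hg, resultant_one_right, coeff_map, coeff_map]
    nontriviality R
    rw [reverse, coeff_reflect, revAt_le le_rfl, Nat.sub_self, hp]
    simp
  exact h

/-- The product of `p = ∏ (1 - a t)` and `q = ∏ (1 - b t)`: `p ⊙ q = ∏ q(a t) = ∏ (1 - a b t)`. -/
noncomputable def wmul {R : Type*} [CommRing R] (p q : R[X]) : R[X] :=
  rootProd p ((q.map C).comp (C X * X))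

/-- The `n`-th Frobenius of `p = ∏ (1 - a t)`: `F_n p = ∏ (1 - a ^ n t)`. -/
noncomputable def wfrob {R : Type*} [CommRing R] (n : ℕ+) (p : R[X]) : R[X] :=
  rootProd p (1 - C X * X ^ (n : ℕ))

lemma scale_coeff_zero {R : Type*} [CommRing R] (q : R[X]) (hq : q.coeff 0 = 1) :
    ((q.map (C : R →+* R[X])).comp (C X * X)).coeff 0 = 1 := by
  rw [comp_C_mul_X_coeff]; simp [hq]

lemma frobPoly_coeff_zero {R : Type*} [CommRing R] (n : ℕ+) :
    (1 - C X * X ^ (n : ℕ) : R[X][X]).coeff 0 = 1 := by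
  simp [n.ne_zero.symm]

lemma wmul_coeff_zero {R : Type*} [CommRing R] (p q : R[X]) (hp : p.coeff 0 = 1)
    (hq : q.coeff 0 = 1) : (wmul p q).coeff 0 = 1 := by
  refine rootProd_coeff_zero p _ hp ?_
  rw [Polynomial.map_comp, Polynomial.map_map]
  simp only [Polynomial.map_mul, map_C, map_X]
  have : (constantCoeff (X : R[X])) = 0 := by simp
  rw [this, C_0, zero_mul, comp_zero, ← coeff_zero_eq_eval_zero, coeff_map, hq]
  simp

lemma wfrob_coeff_zero {R : Type*} [CommRing R] (n : ℕ+) (p : R[X]) (hp : p.coeff 0 = 1) :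
    (wfrob n p).coeff 0 = 1 := by
  refine rootProd_coeff_zero p _ hp ?_
  simp

lemma wmul_map {R S : Type*} [CommRing R] [CommRing S] (f : R →+* S) (p q : R[X])
    (hp : p.coeff 0 = 1) (hq : q.coeff 0 = 1) :
    wmul (p.map f) (q.map f) = (wmul p q).map f := by
  rw [wmul, wmul, ← rootProd_map f p _ hp (scale_coeff_zero q hq)]
  refine congrArg (rootProd (p.map f)) ?_
  rw [Polynomial.map_comp, Polynomial.map_map, Polynomial.map_map]
  congr 1
  · congr 1; ext x; simp
  · simp

lemma wfrob_map {R S : Type*} [CommRing R] [CommRing S] (f : R →+* S) (n : ℕ+) (p : R[X])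
    (hp : p.coeff 0 = 1) : wfrob n (p.map f) = (wfrob n p).map f := by
  rw [wfrob, wfrob, ← rootProd_map f p _ hp (frobPoly_coeff_zero n)]
  refine congrArg (rootProd (p.map f)) ?_
  simp

lemma wmul_linear {R : Type*} [CommRing R] (a : R) (q : R[X]) (hq : q.coeff 0 = 1) :
    wmul (1 - C a * X) q = q.comp (C a * X) := by
  rw [wmul, rootProd_linear _ _ (scale_coeff_zero q hq), eval_comp, eval_map]
  simp only [eval_mul, eval_C, eval_X, mul_comm X]
  rfl

lemma wfrob_linear {R : Type*} [CommRing R] (n : ℕ+) (a : R) :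
    wfrob n (1 - C a * X) = 1 - C (a ^ (n : ℕ)) * X := by
  rw [wfrob, rootProd_linear _ _ (frobPoly_coeff_zero n)]
  simp only [eval_sub, eval_one, eval_mul, eval_C, eval_pow, eval_X, C_pow]
  rw [mul_comm]

lemma wmul_mul_left {R : Type*} [CommRing R] (p q r : R[X]) (hp : p.coeff 0 = 1)
    (hq : q.coeff 0 = 1) (hr : r.coeff 0 = 1) : wmul (p * q) r = wmul p r * wmul q r :=
  rootProd_mul_left p q _ hp hq (scale_coeff_zero r hr)

lemma wmul_mul_right {R : Type*} [CommRing R] (p q r : R[X]) (hp : p.coeff 0 = 1)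
    (hq : q.coeff 0 = 1) (hr : r.coeff 0 = 1) : wmul p (q * r) = wmul p q * wmul p r := by
  rw [wmul, Polynomial.map_mul, mul_comp]
  exact rootProd_mul_right p _ _ hp (scale_coeff_zero q hq) (scale_coeff_zero r hr)

lemma wfrob_mul {R : Type*} [CommRing R] (n : ℕ+) (p q : R[X]) (hp : p.coeff 0 = 1)
    (hq : q.coeff 0 = 1) : wfrob n (p * q) = wfrob n p * wfrob n q :=
  rootProd_mul_left p q _ hp hq (frobPoly_coeff_zero n)

lemma exists_split {R : Type*} [CommRing R] (p q r : R[X]) (hp : p.coeff 0 = 1)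
    (hq : q.coeff 0 = 1) (hr : r.coeff 0 = 1)
    (P : ∀ {S : Type _} [CommRing S], S[X] → S[X] → S[X] → Prop)
    (closed : ∀ (K : Type _) [Field K] (_ : IsAlgClosed K) (p q r : K[X]), p.coeff 0 = 1 →
      q.coeff 0 = 1 → r.coeff 0 = 1 → P p q r)
    (inj : ∀ (S T : Type _) [CommRing S] [CommRing T] (f : S →+* T), Function.Injective f →
      ∀ p q r : S[X], p.coeff 0 = 1 → q.coeff 0 = 1 → r.coeff 0 = 1 →
        P (p.map f) (q.map f) (r.map f) → P p q r)
    (push : ∀ (S T : Type _) [CommRing S] [CommRing T] (f : S →+* T),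
      ∀ p q r : S[X], p.coeff 0 = 1 → q.coeff 0 = 1 → r.coeff 0 = 1 →
        P p q r → P (p.map f) (q.map f) (r.map f)) : P p q r := by
  let φ : MvPolynomial R ℤ →+* R := MvPolynomial.eval₂Hom (algebraMap ℤ R) id
  have hφ : Function.Surjective φ := fun x ↦ ⟨.X x, by simp [φ]⟩
  have lift : ∀ p : R[X], p.coeff 0 = 1 → ∃ p' : (MvPolynomial R ℤ)[X],
      p'.coeff 0 = 1 ∧ p'.map φ = p := by
    intro p hp
    obtain ⟨p', rfl⟩ := Polynomial.map_surjective φ hφ p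
    refine ⟨p' - C (p'.coeff 0 - 1), by simp, ?_⟩
    rw [coeff_map] at hp
    simp [hp]
  obtain ⟨p', hp', rfl⟩ := lift p hp
  obtain ⟨q', hq', rfl⟩ := lift q hq
  obtain ⟨r', hr', rfl⟩ := lift r hr
  refine push _ _ φ _ _ _ hp' hq' hr' ?_
  refine inj _ (AlgebraicClosure (FractionRing (MvPolynomial R ℤ)))
    ((algebraMap (FractionRing (MvPolynomial R ℤ)) _).comp (algebraMap _ _)) ?_ _ _ _
    hp' hq' hr' (closed _ inferInstance _ _ _ (by simp [hp']) (by simp [hq']) (by simp [hr']))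
  exact (algebraMap (FractionRing (MvPolynomial R ℤ)) _).injective.comp (IsFractionRing.injective _ _)

/-- Over an algebraically closed field, every polynomial with constant coefficient `1` is a product
of factors `1 - a t`. -/
lemma split_induction {K : Type*} [Field K] [IsAlgClosed K] {Q : ∀ p : K[X], p.coeff 0 = 1 → Prop}
    (one : Q 1 coeff_one_zero)
    (step : ∀ (a : K) (p : K[X]) (hp : p.coeff 0 = 1), Q p hp →
      Q ((1 - C a * X) * p) (by simp [hp]))
    (p : K[X]) (hp : p.coeff 0 = 1) : Q p hp := by
  induction hn : p.natDegree generalizing p with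
  | zero =>
    obtain rfl : p = 1 := by rw [eq_C_of_natDegree_eq_zero hn, hp, C_1]
    exact one
  | succ n ih =>
    obtain ⟨z, hz⟩ := IsAlgClosed.exists_root p (by
      intro h; rw [natDegree_eq_of_degree_eq_some (n := 0) h] at hn; omega)
    have hz0 : z ≠ 0 := by
      rintro rfl
      rw [IsRoot, ← coeff_zero_eq_eval_zero, hp] at hz
      exact one_ne_zero hz
    obtain ⟨s, rfl⟩ := dvd_iff_isRoot.mpr hz
    have e : (X - C z) * s = (1 - C z⁻¹ * X) * (C (-z) * s) := by
      have : C z⁻¹ * C z = (1 : K[X]) := by rw [← C_mul, inv_mul_cancel₀ hz0, C_1]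
      rw [C_neg]
      linear_combination (- X * s) * this
    have h0 : (C (-z) * s).coeff 0 = 1 := by
      rw [← hp, mul_coeff_zero, mul_coeff_zero]; simp
    simp only [e]
    refine step _ _ h0 (ih _ h0 ?_)
    have hs : s ≠ 0 := by rintro rfl; simp at hn
    rw [natDegree_mul (X_sub_C_ne_zero z) hs, natDegree_X_sub_C] at hn
    rw [natDegree_C_mul (neg_ne_zero.mpr hz0)]
    omega

lemma lin_coeff_zero {R : Type*} [CommRing R] (a : R) : (1 - C a * X : R[X]).coeff 0 = 1 := by simp

lemma wmul_one_left {R : Type*} [CommRing R] (q : R[X]) : wmul 1 q = 1 := rootProd_one _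

lemma wmul_linear_linear {R : Type*} [CommRing R] (a b : R) :
    wmul (1 - C a * X) (1 - C b * X) = 1 - C (a * b) * X := by
  rw [wmul_linear _ _ (lin_coeff_zero b)]
  simp only [sub_comp, one_comp, mul_comp, C_comp, X_comp, C_mul]
  ring

lemma wmul_one_right {R : Type*} [CommRing R] (p : R[X]) (hp : p.coeff 0 = 1) : wmul p 1 = 1 := by
  rw [wmul]
  simp only [Polynomial.map_one, one_comp]
  rw [rootProd, resultant_one_right, coeff_map, reverse, coeff_reflect, revAt_le le_rfl,
    Nat.sub_self, hp]
  simp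

lemma wmul_comm {R : Type*} [CommRing R] (p q : R[X]) (hp : p.coeff 0 = 1) (hq : q.coeff 0 = 1) :
    wmul p q = wmul q p := by
  refine exists_split p q 1 hp hq (by simp) (fun {S} _ p q _ ↦ wmul p q = wmul q p) ?_ ?_ ?_
  · intro K _ _ p q _ hp hq _
    induction p, hp using split_induction with
    | one => rw [wmul_one_left, wmul_one_right q hq]
    | step a p hp ih =>
      rw [wmul_mul_left _ _ _ (lin_coeff_zero a) hp hq, wmul_mul_right _ _ _ hq (lin_coeff_zero a) hp,
        ih]
      refine congrArg (· * _) ?_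
      clear ih
      induction q, hq using split_induction with
      | one => rw [wmul_one_left, wmul_one_right _ (lin_coeff_zero a)]
      | step b q hq ih =>
        rw [wmul_mul_left _ _ _ (lin_coeff_zero b) hq (lin_coeff_zero a),
          wmul_mul_right _ _ _ (lin_coeff_zero a) (lin_coeff_zero b) hq, ih, wmul_linear_linear,
          wmul_linear_linear, mul_comm a b]
  · intro S T _ _ f hf p q r hp hq hr h
    rw [wmul_map f _ _ hp hq, wmul_map f _ _ hq hp] at h
    exact map_injective f hf h
  · intro S T _ _ f p q r hp hq hr h
    rw [wmul_map f _ _ hp hq, wmul_map f _ _ hq hp, h]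

lemma wmul_assoc {R : Type*} [CommRing R] (p q r : R[X]) (hp : p.coeff 0 = 1) (hq : q.coeff 0 = 1)
    (hr : r.coeff 0 = 1) : wmul (wmul p q) r = wmul p (wmul q r) := by
  refine exists_split p q r hp hq hr
    (fun {S} _ p q r ↦ wmul (wmul p q) r = wmul p (wmul q r)) ?_ ?_ ?_
  · intro K _ _ p q r hp hq hr
    have lin := @lin_coeff_zero K _
    induction p, hp using split_induction with
    | one => simp only [wmul_one_left]
    | step a p hp ih =>
      rw [wmul_mul_left _ _ _ (lin a) hp hq, wmul_mul_left _ _ _ (wmul_coeff_zero _ _ (lin a) hq)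
        (wmul_coeff_zero _ _ hp hq) hr, ih, wmul_mul_left _ _ _ (lin a) hp
        (wmul_coeff_zero _ _ hq hr)]
      refine congrArg (· * _) ?_
      clear ih
      induction q, hq using split_induction with
      | one => simp only [wmul_one_left, wmul_one_right _ (lin a)]
      | step b q hq ih =>
        rw [wmul_mul_right _ _ _ (lin a) (lin b) hq, wmul_linear_linear,
          wmul_mul_left _ _ _ (lin _) (wmul_coeff_zero _ _ (lin a) hq) hr, ih,
          wmul_mul_left _ _ _ (lin b) hq hr, wmul_mul_right _ _ _ (lin a)
          (wmul_coeff_zero _ _ (lin b) hr) (wmul_coeff_zero _ _ hq hr)]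
        refine congrArg (· * _) ?_
        rw [wmul_linear _ _ hr, wmul_linear _ _ hr,
          wmul_linear _ _ (by rw [← wmul_linear _ _ hr]; exact wmul_coeff_zero _ _ (lin b) hr),
          comp_assoc]
        simp only [mul_comp, C_comp, X_comp, C_mul]
        rw [mul_assoc, mul_left_comm]
  · intro S T _ _ f hf p q r hp hq hr h
    rw [wmul_map f _ _ hp hq, wmul_map f _ _ hq hr, wmul_map f _ _ hp (wmul_coeff_zero _ _ hq hr),
      wmul_map f _ _ (wmul_coeff_zero _ _ hp hq) hr] at h
    exact map_injective f hf h
  · intro S T _ _ f p q r hp hq hr h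
    rw [wmul_map f _ _ hp hq, wmul_map f _ _ hq hr, wmul_map f _ _ hp (wmul_coeff_zero _ _ hq hr),
      wmul_map f _ _ (wmul_coeff_zero _ _ hp hq) hr, h]

lemma wfrob_one {R : Type*} [CommRing R] (n : ℕ+) : wfrob n (1 : R[X]) = 1 := rootProd_one _

lemma wfrob_wmul {R : Type*} [CommRing R] (n : ℕ+) (p q : R[X]) (hp : p.coeff 0 = 1)
    (hq : q.coeff 0 = 1) : wfrob n (wmul p q) = wmul (wfrob n p) (wfrob n q) := by
  refine exists_split p q 1 hp hq (by simp)
    (fun {S} _ p q _ ↦ wfrob n (wmul p q) = wmul (wfrob n p) (wfrob n q)) ?_ ?_ ?_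
  · intro K _ _ p q _ hp hq _
    have lin := @lin_coeff_zero K _
    induction p, hp using split_induction with
    | one => simp only [wmul_one_left, wfrob_one]
    | step a p hp ih =>
      rw [wmul_mul_left _ _ _ (lin a) hp hq, wfrob_mul n _ _ (wmul_coeff_zero _ _ (lin a) hq)
        (wmul_coeff_zero _ _ hp hq), ih, wfrob_mul n _ _ (lin a) hp,
        wmul_mul_left _ _ _ (wfrob_coeff_zero n _ (lin a)) (wfrob_coeff_zero n _ hp)
        (wfrob_coeff_zero n _ hq)]
      refine congrArg (· * _) ?_
      clear ih
      induction q, hq using split_induction with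
      | one => rw [wfrob_one, wmul_one_right _ (lin a), wfrob_linear, wmul_one_right _ (lin _),
          wfrob_one]
      | step b q hq ih =>
        rw [wmul_mul_right _ _ _ (lin a) (lin b) hq, wfrob_mul n _ _
          (wmul_coeff_zero _ _ (lin a) (lin b)) (wmul_coeff_zero _ _ (lin a) hq), ih,
          wfrob_mul n _ _ (lin b) hq, wmul_mul_right _ _ _ (wfrob_coeff_zero n _ (lin a))
          (wfrob_coeff_zero n _ (lin b)) (wfrob_coeff_zero n _ hq), wmul_linear_linear,
          wfrob_linear, wfrob_linear, wfrob_linear, wmul_linear_linear, mul_pow]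
  · intro S T _ _ f hf p q r hp hq hr h
    rw [wmul_map f _ _ hp hq, wfrob_map f n _ hp, wfrob_map f n _ hq,
      wfrob_map f n _ (wmul_coeff_zero _ _ hp hq),
      wmul_map f _ _ (wfrob_coeff_zero n _ hp) (wfrob_coeff_zero n _ hq)] at h
    exact map_injective f hf h
  · intro S T _ _ f p q r hp hq hr h
    rw [wmul_map f _ _ hp hq, wfrob_map f n _ hp, wfrob_map f n _ hq,
      wfrob_map f n _ (wmul_coeff_zero _ _ hp hq),
      wmul_map f _ _ (wfrob_coeff_zero n _ hp) (wfrob_coeff_zero n _ hq), h]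

lemma wfrob_wfrob {R : Type*} [CommRing R] (m n : ℕ+) (p : R[X]) (hp : p.coeff 0 = 1) :
    wfrob m (wfrob n p) = wfrob (m * n) p := by
  refine exists_split p 1 1 hp (by simp) (by simp)
    (fun {S} _ p _ _ ↦ wfrob m (wfrob n p) = wfrob (m * n) p) ?_ ?_ ?_
  · intro K _ _ p _ _ hp _ _
    have lin := @lin_coeff_zero K _
    induction p, hp using split_induction with
    | one => simp only [wfrob_one]
    | step a p hp ih =>
      rw [wfrob_mul _ _ _ (lin a) hp, wfrob_mul _ _ _ (lin a) hp, wfrob_mul _ _ _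
        (wfrob_coeff_zero n _ (lin a)) (wfrob_coeff_zero n _ hp), ih, wfrob_linear, wfrob_linear,
        wfrob_linear, ← pow_mul, PNat.mul_coe, mul_comm (n : ℕ)]
  · intro S T _ _ f hf p q r hp _ _ h
    rw [wfrob_map f n _ hp, wfrob_map f m _ (wfrob_coeff_zero n _ hp), wfrob_map f _ _ hp] at h
    exact map_injective f hf h
  · intro S T _ _ f p q r hp _ _ h
    rw [wfrob_map f n _ hp, wfrob_map f m _ (wfrob_coeff_zero n _ hp), wfrob_map f _ _ hp, h]


/-- The monoid of polynomials with constant coefficient `1`. -/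
def onePoly (R : Type*) [CommRing R] : Submonoid R[X] where
  carrier := {p | p.coeff 0 = 1}
  mul_mem' {p q} hp hq := by
    change (p * q).coeff 0 = 1
    rw [mul_coeff_zero, show p.coeff 0 = 1 from hp, show q.coeff 0 = 1 from hq, mul_one]
  one_mem' := coeff_one_zero

end RatWitt

open RatWitt

/-- The ring `W_rat(R)` of rational Witt vectors: the group of fractions `P(t) / Q(t)` of polynomials
with `P(0) = Q(0) = 1`. Addition is the product of fractions; multiplication is the biadditive
extension of `⊙`. -/
def WRat (R : Type*) [CommRing R] : Type _ := Algebra.GrothendieckAddGroup (Additive (onePoly R))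

namespace WRat

noncomputable instance (R : Type*) [CommRing R] : AddCommGroup (WRat R) :=
  inferInstanceAs (AddCommGroup (Algebra.GrothendieckAddGroup (Additive (onePoly R))))

/-- The class of a polynomial with constant coefficient `1`. -/
noncomputable def of {R : Type*} [CommRing R] : Additive (onePoly R) →+ WRat R :=
  Algebra.GrothendieckAddGroup.of

/-- Additive maps out of `W_rat(R)` are determined by, and may be prescribed on, polynomials. -/
noncomputable def lift {R A : Type*} [CommRing R] [AddCommGroup A] :
    (Additive (onePoly R) →+ A) ≃ (WRat R →+ A) :=
  Algebra.GrothendieckAddGroup.lift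

lemma lift_of {R A : Type*} [CommRing R] [AddCommGroup A] (f : Additive (onePoly R) →+ A)
    (p : Additive (onePoly R)) : lift f (of p) = f p :=
  DFunLike.congr_fun (Algebra.GrothendieckAddGroup.lift.symm_apply_apply f) p

lemma hom_ext {R A : Type*} [CommRing R] [AddCommGroup A] {f g : WRat R →+ A}
    (h : ∀ p, f (of p) = g (of p)) : f = g :=
  lift.symm.injective (AddMonoidHom.ext h)

/-- The product `⊙` on polynomials with constant coefficient `1`, as a biadditive map. -/
noncomputable def mulPoly (R : Type*) [CommRing R] :
    Additive (onePoly R) →+ Additive (onePoly R) →+ Additive (onePoly R) where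
  toFun p :=
    { toFun := fun q ↦ .ofMul ⟨wmul p.toMul.1 q.toMul.1, wmul_coeff_zero _ _ p.toMul.2 q.toMul.2⟩
      map_zero' := congrArg Additive.ofMul (Subtype.ext (wmul_one_right _ p.toMul.2))
      map_add' := fun q r ↦ congrArg Additive.ofMul
        (Subtype.ext (wmul_mul_right _ _ _ p.toMul.2 q.toMul.2 r.toMul.2)) }
  map_zero' := AddMonoidHom.ext fun _ ↦ congrArg Additive.ofMul (Subtype.ext (wmul_one_left _))
  map_add' p q := AddMonoidHom.ext fun r ↦ congrArg Additive.ofMul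
    (Subtype.ext (wmul_mul_left _ _ _ p.toMul.2 q.toMul.2 r.toMul.2))

lemma mulPoly_comm {R : Type*} [CommRing R] (p q : Additive (onePoly R)) :
    mulPoly R p q = mulPoly R q p :=
  congrArg Additive.ofMul (Subtype.ext (wmul_comm _ _ p.toMul.2 q.toMul.2))

lemma mulPoly_assoc {R : Type*} [CommRing R] (p q r : Additive (onePoly R)) :
    mulPoly R (mulPoly R p q) r = mulPoly R p (mulPoly R q r) :=
  congrArg Additive.ofMul (Subtype.ext (wmul_assoc _ _ _ p.toMul.2 q.toMul.2 r.toMul.2))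

/-- The class of `1 - a t`, as an element of the additive monoid of polynomials. -/
noncomputable def linPoly {R : Type*} [CommRing R] (a : R) : Additive (onePoly R) :=
  .ofMul ⟨1 - C a * X, lin_coeff_zero a⟩

lemma mulPoly_one {R : Type*} [CommRing R] (p : Additive (onePoly R)) :
    mulPoly R (linPoly 1) p = p :=
  congrArg Additive.ofMul (Subtype.ext (by
    change wmul (1 - C 1 * X) p.toMul.1 = p.toMul.1
    rw [wmul_linear _ _ p.toMul.2]; simp))

/-- The multiplication of `W_rat(R)`, as a biadditive map. -/
noncomputable def mulHom (R : Type*) [CommRing R] : WRat R →+ WRat R →+ WRat R :=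
  lift
    { toFun := fun p ↦ lift (of.comp (mulPoly R p))
      map_zero' := hom_ext fun q ↦ by simp [lift_of]
      map_add' := fun p q ↦ hom_ext fun r ↦ by simp [lift_of] }

lemma mulHom_of {R : Type*} [CommRing R] (p q : Additive (onePoly R)) :
    mulHom R (of p) (of q) = of (mulPoly R p q) := by
  rw [mulHom, lift_of]
  exact lift_of _ q

lemma mulHom_comm {R : Type*} [CommRing R] (x y : WRat R) : mulHom R x y = mulHom R y x := by
  have : mulHom R = (mulHom R).flip := hom_ext fun p ↦ hom_ext fun q ↦ by
    rw [AddMonoidHom.flip_apply, mulHom_of, mulHom_of, mulPoly_comm]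
  exact DFunLike.congr_fun (DFunLike.congr_fun this x) y

lemma mulHom_assoc {R : Type*} [CommRing R] (x y z : WRat R) :
    mulHom R (mulHom R x y) z = mulHom R x (mulHom R y z) := by
  have h1 : ((mulHom R).flip z).comp ((mulHom R).flip y) = (mulHom R).flip (mulHom R y z) := by
    refine hom_ext fun p ↦ ?_
    have h2 : ((mulHom R).flip z).comp (mulHom R (of p)) =
        (mulHom R (of p)).comp ((mulHom R).flip z) := by
      refine hom_ext fun q ↦ ?_
      have h3 : mulHom R (mulHom R (of p) (of q)) =
          (mulHom R (of p)).comp (mulHom R (of q)) := by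
        refine hom_ext fun r ↦ ?_
        simp only [AddMonoidHom.comp_apply, mulHom_of, mulPoly_assoc]
      exact DFunLike.congr_fun h3 z
    exact DFunLike.congr_fun h2 y
  exact DFunLike.congr_fun h1 x

lemma mulHom_one {R : Type*} [CommRing R] (x : WRat R) : mulHom R (of (linPoly 1)) x = x := by
  have : mulHom R (of (linPoly 1)) = AddMonoidHom.id _ := hom_ext fun p ↦ by
    rw [mulHom_of, mulPoly_one, AddMonoidHom.id_apply]
  exact DFunLike.congr_fun this x

noncomputable instance (R : Type*) [CommRing R] : CommRing (WRat R) :=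
  { (inferInstance : AddCommGroup (WRat R)) with
    mul := fun x y ↦ mulHom R x y
    one := of (linPoly 1)
    left_distrib := fun x y z ↦ map_add (mulHom R x) y z
    right_distrib := fun x y z ↦ DFunLike.congr_fun (map_add (mulHom R) x y) z
    zero_mul := fun x ↦ DFunLike.congr_fun (map_zero (mulHom R)) x
    mul_zero := fun x ↦ map_zero (mulHom R x)
    mul_assoc := mulHom_assoc
    one_mul := mulHom_one
    mul_one := fun x ↦ (mulHom_comm x _).trans (mulHom_one x)
    mul_comm := mulHom_comm }

lemma of_mul {R : Type*} [CommRing R] (p q : Additive (onePoly R)) :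
    (of p * of q : WRat R) = of (mulPoly R p q) := mulHom_of p q

lemma ringHom_ext {R A : Type*} [CommRing R] [Ring A] {f g : WRat R →+* A}
    (h : ∀ p, f (of p) = g (of p)) : f = g :=
  RingHom.ext fun x ↦ DFunLike.congr_fun (hom_ext (f := (f : WRat R →+ A)) (g := (g : WRat R →+ A)) h) x

/-- The ring homomorphism of rational Witt vectors given by a map of polynomials that respects
products and `⊙`. -/
noncomputable def homOfPoly {R S : Type*} [CommRing R] [CommRing S]
    (g : Additive (onePoly R) →+ Additive (onePoly S)) (one : g (linPoly 1) = linPoly 1)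
    (mul : ∀ p q, g (mulPoly R p q) = mulPoly S (g p) (g q)) : WRat R →+* WRat S :=
  { lift (of.comp g) with
    map_one' := (lift_of (of.comp g) _).trans (congrArg of one)
    map_mul' := by
      intro x y
      have h : (mulHom R).compr₂ (lift (of.comp g)) =
          ((mulHom S).comp (lift (of.comp g))).compl₂ (lift (of.comp g)) :=
        hom_ext fun p ↦ hom_ext fun q ↦ by
          simp only [AddMonoidHom.compr₂_apply, mulHom_of, lift_of, AddMonoidHom.compl₂_apply,
            AddMonoidHom.comp_apply, mul]
      exact DFunLike.congr_fun (DFunLike.congr_fun h x) y }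

lemma homOfPoly_of {R S : Type*} [CommRing R] [CommRing S]
    (g : Additive (onePoly R) →+ Additive (onePoly S)) (one : g (linPoly 1) = linPoly 1)
    (mul : ∀ p q, g (mulPoly R p q) = mulPoly S (g p) (g q)) (p : Additive (onePoly R)) :
    homOfPoly g one mul (of p) = of (g p) := lift_of (of.comp g) p

/-- The Teichmüller map `[a] = 1 - a t`. -/
noncomputable def teich (R : Type*) [CommRing R] : R →* WRat R where
  toFun a := of (linPoly a)
  map_one' := rfl
  map_mul' a b := by
    rw [of_mul]
    exact congrArg of (congrArg Additive.ofMul (Subtype.ext (wmul_linear_linear a b).symm))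

/-- A ring homomorphism applied to the coefficients of a polynomial. -/
noncomputable def mapPoly {R S : Type*} [CommRing R] [CommRing S] (f : R →+* S) :
    Additive (onePoly R) →+ Additive (onePoly S) where
  toFun p := .ofMul ⟨p.toMul.1.map f, by
    change (p.toMul.1.map f).coeff 0 = 1
    rw [coeff_map, show p.toMul.1.coeff 0 = 1 from p.toMul.2, map_one]⟩
  map_zero' := congrArg Additive.ofMul (Subtype.ext (Polynomial.map_one f))
  map_add' _ _ := congrArg Additive.ofMul (Subtype.ext (Polynomial.map_mul f))

lemma mapPoly_lin {R S : Type*} [CommRing R] [CommRing S] (f : R →+* S) (a : R) :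
    mapPoly f (linPoly a) = linPoly (f a) :=
  congrArg Additive.ofMul (Subtype.ext (by
    change (1 - C a * X : R[X]).map f = 1 - C (f a) * X
    simp))

lemma mapPoly_mul {R S : Type*} [CommRing R] [CommRing S] (f : R →+* S)
    (p q : Additive (onePoly R)) : mapPoly f (mulPoly R p q) = mulPoly S (mapPoly f p) (mapPoly f q) :=
  congrArg Additive.ofMul (Subtype.ext (wmul_map f _ _ p.toMul.2 q.toMul.2).symm)

/-- The ring homomorphism `W_rat(R) → W_rat(S)` that applies `f : R → S` to coefficients. -/
noncomputable def mapHom {R S : Type*} [CommRing R] [CommRing S] (f : R →+* S) :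
    WRat R →+* WRat S :=
  homOfPoly (mapPoly f) ((mapPoly_lin f 1).trans (congrArg linPoly (map_one f))) (mapPoly_mul f)

lemma mapHom_of {R S : Type*} [CommRing R] [CommRing S] (f : R →+* S) (p : Additive (onePoly R)) :
    mapHom f (of p) = of (mapPoly f p) := homOfPoly_of _ _ _ _

/-- `F_n` on polynomials. -/
noncomputable def frobPoly {R : Type*} [CommRing R] (n : ℕ+) :
    Additive (onePoly R) →+ Additive (onePoly R) where
  toFun p := .ofMul ⟨wfrob n p.toMul.1, wfrob_coeff_zero n _ p.toMul.2⟩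
  map_zero' := congrArg Additive.ofMul (Subtype.ext (wfrob_one n))
  map_add' p q := congrArg Additive.ofMul (Subtype.ext (wfrob_mul n _ _ p.toMul.2 q.toMul.2))

lemma frobPoly_lin {R : Type*} [CommRing R] (n : ℕ+) (a : R) :
    frobPoly n (linPoly a) = linPoly (a ^ (n : ℕ)) :=
  congrArg Additive.ofMul (Subtype.ext (wfrob_linear n a))

lemma frobPoly_mul {R : Type*} [CommRing R] (n : ℕ+) (p q : Additive (onePoly R)) :
    frobPoly n (mulPoly R p q) = mulPoly R (frobPoly n p) (frobPoly n q) :=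
  congrArg Additive.ofMul (Subtype.ext (wfrob_wmul n _ _ p.toMul.2 q.toMul.2))

/-- The Frobenius endomorphism `F_n` of `W_rat(R)`, with `F_n [a] = [a ^ n]`. -/
noncomputable def frob (R : Type*) [CommRing R] (n : ℕ+) : WRat R →+* WRat R :=
  homOfPoly (frobPoly n) ((frobPoly_lin n 1).trans (congrArg linPoly (one_pow _))) (frobPoly_mul n)

lemma frob_of {R : Type*} [CommRing R] (n : ℕ+) (p : Additive (onePoly R)) :
    frob R n (of p) = of (frobPoly n p) := homOfPoly_of _ _ _ _

lemma frob_teich {R : Type*} [CommRing R] (n : ℕ+) (a : R) :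
    frob R n (teich R a) = teich R (a ^ (n : ℕ)) :=
  (frob_of n _).trans (congrArg of (frobPoly_lin n a))

lemma frob_comp_frob {R : Type*} [CommRing R] (m n : ℕ+) :
    (frob R m).comp (frob R n) = frob R (m * n) := by
  refine ringHom_ext fun p ↦ ?_
  rw [RingHom.comp_apply, frob_of, frob_of, frob_of]
  exact congrArg of (congrArg Additive.ofMul (Subtype.ext (wfrob_wfrob m n _ p.toMul.2)))

lemma mapHom_comp_frob {R S : Type*} [CommRing R] [CommRing S] (f : R →+* S) (n : ℕ+) :
    (mapHom f).comp (frob R n) = (frob S n).comp (mapHom f) := by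
  refine ringHom_ext fun p ↦ ?_
  rw [RingHom.comp_apply, RingHom.comp_apply, frob_of, mapHom_of, mapHom_of, frob_of]
  exact congrArg of (congrArg Additive.ofMul (Subtype.ext (wfrob_map f n _ p.toMul.2).symm))

lemma mapHom_teich {R S : Type*} [CommRing R] [CommRing S] (f : R →+* S) (a : R) :
    mapHom f (teich R a) = teich S (f a) :=
  (mapHom_of f _).trans (congrArg of (mapPoly_lin f a))

end WRat

noncomputable section

open NumberField IsDedekindDomain

/-- The algebraic closure of `ℚ` in `ℂ`. -/
abbrev Qbar : Type := ↥(algebraicClosure ℚ ℂ)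

/-- The maximal abelian extension of `ℚ` in `Qbar`. -/
def maxAbelian : IntermediateField ℚ Qbar := sSup {E | IsAbelianGalois ℚ E}

/-- `ℚ^ab`. -/
abbrev Qab : Type := ↥maxAbelian

instance : Normal ℚ Qab := by
  have e : maxAbelian = ⨆ i : {E : IntermediateField ℚ Qbar | IsAbelianGalois ℚ E}, i.1 :=
    sSup_eq_iSup' _
  have : ∀ i : {E : IntermediateField ℚ Qbar | IsAbelianGalois ℚ E}, Normal ℚ i.1 := fun i ↦ by
    have : IsAbelianGalois ℚ i.1 := i.2
    infer_instance
  have h : Normal ℚ ↥(⨆ i : {E : IntermediateField ℚ Qbar | IsAbelianGalois ℚ E}, i.1) :=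
    IntermediateField.normal_iSup (F := ℚ) (K := Qbar) _ (h := this)
  rwa [← e] at h

/-- The group `ℚ_+` of positive rational numbers. -/
abbrev PosRat : Type := {q : ℚ // 0 < q}

/-- The group `ℝ_+` of positive real numbers. -/
abbrev PosReal : Type := {u : ℝ // 0 < u}

/-- The inclusion `ℚ_+ ⊂ ℝ_+`. -/
def PosRat.toReal (q : PosRat) : PosReal := ⟨(q.1 : ℝ), by exact_mod_cast q.2⟩

/-- The numerator of a positive rational number in lowest terms. -/
def PosRat.num (q : PosRat) : ℕ+ := ⟨q.1.num.toNat, by have := Rat.num_pos.mpr q.2; omega⟩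

/-- The denominator of a positive rational number in lowest terms. -/
def PosRat.den (q : PosRat) : ℕ+ := ⟨q.1.den, q.1.den_pos⟩

/-! ### Deninger's spaces -/

/-- The set of `ℂ`-valued points of the rational Witt space of `Spec 𝓞_K`: pairs `(𝔭, P)` of a
point `𝔭` of `Spec 𝓞_K` and a ring homomorphism `P : W_rat(κ(𝔭)) → ℂ`. -/
structure XDot (K : Type*) [Field K] where
  prime : PrimeSpectrum (𝓞 K)
  hom : WRat prime.asIdeal.ResidueField →+* ℂ

namespace XDot

/-- The map `(𝔓, P) ↦ (f⁻¹ 𝔓, P ∘ W_rat(f))` induced by a homomorphism of fields `f : K → L`. For an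
inclusion it is the natural projection, for `f = σ` in a Galois group it is the right action of
`σ`. -/
def pull {K L : Type*} [Field K] [Field L] (f : K →+* L) (x : XDot L) : XDot K where
  prime := PrimeSpectrum.comap (RingOfIntegers.mapRingHom f) x.prime
  hom := x.hom.comp (WRat.mapHom
    (Ideal.ResidueField.map _ x.prime.asIdeal (RingOfIntegers.mapRingHom f) rfl))

/-- The Frobenius `F_n (𝔭, P) = (𝔭, P ∘ F_n)`. -/
def frob {K : Type*} [Field K] (n : ℕ+) (x : XDot K) : XDot K where
  prime := x.prime
  hom := x.hom.comp (WRat.frob _ n)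

lemma frob_frob {K : Type*} [Field K] (m n : ℕ+) (x : XDot K) :
    frob m (frob n x) = frob (n * m) x := by
  exact congrArg (XDot.mk x.prime) ((RingHom.comp_assoc _ _ _).trans
    (congrArg x.hom.comp (WRat.frob_comp_frob n m)))

lemma pull_frob {K L : Type*} [Field K] [Field L] (f : K →+* L) (n : ℕ+) (x : XDot L) :
    pull f (frob n x) = frob n (pull f x) := by
  exact congrArg (XDot.mk _) ((RingHom.comp_assoc _ _ _).trans
    ((congrArg x.hom.comp (WRat.mapHom_comp_frob _ n).symm).trans (RingHom.comp_assoc _ _ _).symm))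

/-- The multiplicative map `𝓞_K → ℂ`, `a ↦ P([a mod 𝔭])`, of a point `(𝔭, P)`. -/
def mulMap {K : Type*} [Field K] (x : XDot K) : 𝓞 K →* ℂ where
  toFun a := x.hom (WRat.teich _ (algebraMap (𝓞 K) x.prime.asIdeal.ResidueField a))
  map_one' := by simp only [map_one]
  map_mul' a b := by simp only [map_mul]

/-- For `K = Qbar` the points are multiplicative maps `𝓞_K → ℂ`; the topology is that of pointwise
convergence. -/
abbrev pointwiseTopology : TopologicalSpace (XDot Qbar) := .induced (fun x a ↦ x.mulMap a) inferInstance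

/-- The quotient topology with respect to the projection from the space of `Qbar`. -/
instance (K : Type*) [Field K] [Algebra K Qbar] : TopologicalSpace (XDot K) :=
  .coinduced (pull (algebraMap K Qbar)) pointwiseTopology

end XDot

/-- The equivalence relation that defines the inductive limit of copies of `XDot K` indexed by
positive integers ordered by divisibility, with transition maps `F_{m/n}` for `n ∣ m`. -/
def XCheck.setoid (K : Type*) [Field K] : Setoid (Σ _ : ℕ+, XDot K) where
  r x y := ∃ a b : ℕ+, x.1 * a = y.1 * b ∧ x.2.frob a = y.2.frob b
  iseqv :=
    { refl := fun _ ↦ ⟨1, 1, rfl, rfl⟩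
      symm := fun ⟨a, b, h, h'⟩ ↦ ⟨b, a, h.symm, h'.symm⟩
      trans := by
        rintro x y z ⟨a, b, h, h'⟩ ⟨c, d, k, k'⟩
        refine ⟨a * c, d * b, ?_, ?_⟩
        · rw [← mul_assoc, h, ← mul_assoc, ← k, mul_right_comm]
        · rw [← XDot.frob_frob, h', ← XDot.frob_frob, ← k', XDot.frob_frob, XDot.frob_frob,
            mul_comm] }

/-- The inductive limit of the spaces `XDot K` along the Frobenius maps. The class of `(n, x)` is
`F_n⁻¹ x`. -/
def XCheck (K : Type*) [Field K] : Type _ := Quotient (XCheck.setoid K)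

namespace XCheck

instance (K : Type*) [Field K] [Algebra K Qbar] : TopologicalSpace (XCheck K) :=
  inferInstanceAs (TopologicalSpace (Quotient (XCheck.setoid K)))

/-- The class of `(n, x)`. -/
def mk {K : Type*} [Field K] (n : ℕ+) (x : XDot K) : XCheck K := Quotient.mk _ ⟨n, x⟩

/-- The map of inductive limits induced by a homomorphism of fields. -/
def pull {K L : Type*} [Field K] [Field L] (f : K →+* L) : XCheck L → XCheck K :=
  Quotient.map (fun x ↦ ⟨x.1, x.2.pull f⟩) (by
    rintro x y ⟨a, b, h, h'⟩
    exact ⟨a, b, h, by rw [← XDot.pull_frob, h', XDot.pull_frob]⟩)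

/-- The action of `F_q` for `q = a / b` in `ℚ_+`: it sends `F_n⁻¹ x` to `F_{n b}⁻¹ (F_a x)`. -/
def frob {K : Type*} [Field K] (q : PosRat) : XCheck K → XCheck K :=
  Quotient.map (fun x ↦ ⟨x.1 * q.den, x.2.frob q.num⟩) (by
    rintro x y ⟨a, b, h, h'⟩
    refine ⟨a, b, by rw [mul_right_comm, h, mul_right_comm], ?_⟩
    rw [XDot.frob_frob, mul_comm, ← XDot.frob_frob, h', XDot.frob_frob, mul_comm,
      ← XDot.frob_frob])

lemma pull_frob {K L : Type*} [Field K] [Field L] (f : K →+* L) (q : PosRat) (x : XCheck L) :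
    pull f (frob q x) = frob q (pull f x) := by
  induction x using Quotient.inductionOn with
  | h x => exact congrArg (fun z ↦ mk (x.1 * q.den) z) (XDot.pull_frob f _ x.2)

end XCheck

/-- The Deninger system `𝔛_K = XCheck K ×_{ℚ_+} ℝ_+`: the quotient of `XCheck K × ℝ_+` by the action
`(x, u) ↦ (F_q x, q⁻¹ u)` of `ℚ_+`, with the quotient topology. -/
def XFrak (K : Type*) [Field K] : Type _ :=
  Quot fun x y : XCheck K × PosReal ↦ ∃ q : PosRat, y = (x.1.frob q, q.toReal⁻¹ * x.2)

namespace XFrak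

instance (K : Type*) [Field K] [Algebra K Qbar] : TopologicalSpace (XFrak K) :=
  inferInstanceAs (TopologicalSpace (Quot _))

/-- The class `[x, u]`. -/
def mk {K : Type*} [Field K] (x : XCheck K) (u : PosReal) : XFrak K := Quot.mk _ (x, u)

/-- The flow `φ^t [x, u] = [x, t u]`. -/
def flow {K : Type*} [Field K] (t : PosReal) : XFrak K → XFrak K :=
  Quot.map (fun x ↦ (x.1, t * x.2)) (by
    rintro x _ ⟨q, rfl⟩
    exact ⟨q, by rw [mul_left_comm]⟩)

/-- The map of Deninger systems induced by a homomorphism of fields `f : K → L`. -/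
def pull {K L : Type*} [Field K] [Field L] (f : K →+* L) : XFrak L → XFrak K :=
  Quot.map (fun x ↦ (x.1.pull f, x.2)) (by
    rintro x _ ⟨q, rfl⟩
    exact ⟨q, by rw [XCheck.pull_frob]⟩)

/-- The right action of the Galois group, `[(𝔭, P), u]^σ = [(σ⁻¹ 𝔭, P ∘ σ), u]`. -/
def galAct {K : Type*} [Field K] [Algebra ℚ K] (σ : Gal(K/ℚ)) : XFrak K → XFrak K :=
  pull (σ : K →+* K)

/-- The projection `ϖ_{L/K} : 𝔛_L → 𝔛_K`. -/
def proj (K L : Type*) [Field K] [Field L] [Algebra K L] : XFrak L → XFrak K :=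
  pull (algebraMap K L)

end XFrak

/-! ### Roots of unity and the ring of profinite integers -/

/-- The group `μ_∞` of all roots of unity in `ℂ`. -/
abbrev MuInf : Type := ↥(CommGroup.torsion ℂˣ)

/-- The ring `Hom(μ_∞, μ_∞)`: addition is the pointwise product of characters and multiplication is
composition. -/
abbrev HDot : Type := AddMonoid.End (Additive MuInf)

instance instFactPrimes (p : Nat.Primes) : Fact (p : ℕ).Prime := ⟨p.2⟩

/-- The ring of profinite integers `∏_p ℤ_p`. -/
abbrev ZHat : Type := ∀ p : Nat.Primes, ℤ_[p]

lemma exists_primitive (n : ℕ) (hn : n ≠ 0) :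
    ∃ w : MuInf, IsPrimitiveRoot w n ∧ ∀ ζ : MuInf, ζ ^ n = 1 → ∃ i < n, w ^ i = ζ := by
  have : NeZero n := ⟨hn⟩
  have h := Complex.isPrimitiveRoot_exp n hn
  have hu : IsPrimitiveRoot (h.isUnit hn).unit n := h.isUnit_unit hn
  refine ⟨⟨(h.isUnit hn).unit, isOfFinOrder_iff_pow_eq_one.mpr
    ⟨n, Nat.pos_of_ne_zero hn, hu.pow_eq_one⟩⟩, IsPrimitiveRoot.coe_submonoidClass_iff.mp hu, ?_⟩
  intro ζ hζ
  have hζ' : ((ζ.1 : ℂˣ) : ℂ) ^ n = 1 := by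
    rw [← Units.val_pow_eq_pow_val, ← SubgroupClass.coe_pow, hζ]; rfl
  obtain ⟨i, hi, e⟩ := h.eq_pow_of_pow_eq_one hζ'
  exact ⟨i, hi, Subtype.ext (Units.ext (by simpa using e))⟩

lemma pow_val_congr {n : ℕ} {ζ : MuInf} (hζ : ζ ^ n = 1) {k : ZMod n} {l : ℕ}
    (h : k = l) : ζ ^ k.val = ζ ^ l := by
  rw [h, ZMod.val_natCast]
  exact (pow_eq_pow_mod l hζ).symm

lemma exists_expMod (n : ℕ) (hn : n ≠ 0) (χ : HDot) :
    ∃! k : ZMod n, ∀ ζ : MuInf, ζ ^ n = 1 → (χ (.ofMul ζ)).toMul = ζ ^ k.val := by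
  have : NeZero n := ⟨hn⟩
  obtain ⟨w, hw, hgen⟩ := exists_primitive n hn
  have h1 : (χ (.ofMul w)).toMul ^ n = 1 := by
    rw [← toMul_nsmul, ← map_nsmul, ← ofMul_pow, hw.pow_eq_one, ofMul_one, map_zero, toMul_zero]
  obtain ⟨k, hk, e⟩ := hgen _ h1
  refine ⟨(k : ZMod n), fun ζ hζ ↦ ?_, fun l hl ↦ ?_⟩
  · rw [pow_val_congr hζ (l := k) rfl]
    obtain ⟨i, _, rfl⟩ := hgen ζ hζ
    rw [ofMul_pow, map_nsmul, toMul_nsmul, ← e, ← pow_mul, ← pow_mul, mul_comm]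
  · have h2 := hl w hw.pow_eq_one
    rw [← e] at h2
    have h3 := hw.pow_inj hk l.val_lt h2
    rw [h3, ZMod.natCast_zmod_val]

/-- The exponent `k` modulo `n` such that `χ(ζ) = ζ ^ k` for all `n`-th roots of unity `ζ`. -/
def expModFun (n : ℕ) (hn : n ≠ 0) (χ : HDot) : ZMod n := (exists_expMod n hn χ).choose

lemma expModFun_spec (n : ℕ) (hn : n ≠ 0) (χ : HDot) (ζ : MuInf) (hζ : ζ ^ n = 1) :
    (χ (.ofMul ζ)).toMul = ζ ^ (expModFun n hn χ).val :=
  (exists_expMod n hn χ).choose_spec.1 ζ hζ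

lemma expModFun_eq (n : ℕ) (hn : n ≠ 0) (χ : HDot) (l : ℕ)
    (h : ∀ ζ : MuInf, ζ ^ n = 1 → (χ (.ofMul ζ)).toMul = ζ ^ l) : expModFun n hn χ = l :=
  ((exists_expMod n hn χ).choose_spec.2 l fun ζ hζ ↦ by
    rw [pow_val_congr hζ rfl]; exact h ζ hζ).symm

/-- `expModFun` as a ring homomorphism. -/
def expMod (n : ℕ) (hn : n ≠ 0) : HDot →+* ZMod n where
  toFun := expModFun n hn
  map_one' := (expModFun_eq n hn 1 1 fun ζ _ ↦ (pow_one ζ).symm).trans Nat.cast_one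
  map_mul' χ χ' := by
    have : NeZero n := ⟨hn⟩
    refine (expModFun_eq n hn _ ((expModFun n hn χ').val * (expModFun n hn χ).val)
      fun ζ hζ ↦ ?_).trans (by
        rw [Nat.cast_mul, ZMod.natCast_zmod_val, ZMod.natCast_zmod_val, mul_comm])
    change (χ (χ' (.ofMul ζ))).toMul = _
    have e : χ' (.ofMul ζ) = .ofMul (ζ ^ (expModFun n hn χ').val) := expModFun_spec n hn χ' ζ hζ
    rw [e, expModFun_spec n hn χ _ (by rw [← pow_mul, mul_comm, pow_mul, hζ, one_pow]), ← pow_mul]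
  map_zero' := (expModFun_eq n hn 0 0 fun ζ _ ↦ (pow_zero ζ).symm).trans Nat.cast_zero
  map_add' χ χ' := by
    have : NeZero n := ⟨hn⟩
    refine (expModFun_eq n hn _ ((expModFun n hn χ).val + (expModFun n hn χ').val)
      fun ζ hζ ↦ ?_).trans (by
        rw [Nat.cast_add, ZMod.natCast_zmod_val, ZMod.natCast_zmod_val])
    change (χ (.ofMul ζ)).toMul * (χ' (.ofMul ζ)).toMul = _
    rw [expModFun_spec n hn χ ζ hζ, expModFun_spec n hn χ' ζ hζ, pow_add]

lemma expMod_compat (m n : ℕ) (hm : m ≠ 0) (hn : n ≠ 0) (h : m ∣ n) :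
    (ZMod.castHom h (ZMod m)).comp (expMod n hn) = expMod m hm := by
  have : NeZero n := ⟨hn⟩
  refine RingHom.ext fun χ ↦ ?_
  have e := expModFun_eq m hm χ (expModFun n hn χ).val fun ζ hζ ↦ expModFun_spec n hn χ ζ (by
    obtain ⟨c, rfl⟩ := h
    rw [pow_mul, hζ, one_pow])
  refine Eq.trans ?_ e.symm
  change ZMod.castHom h (ZMod m) (expModFun n hn χ) = _
  conv_lhs => rw [← ZMod.natCast_zmod_val (expModFun n hn χ), map_natCast]

/-- The isomorphism `Hom(μ_∞, μ_∞) ≅ ∏_p ℤ_p`, which sends `ζ ↦ ζ ^ a` to `a`. -/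
def HDot.toZHat : HDot →+* ZHat :=
  RingHom.pi fun p ↦
    PadicInt.lift (f := fun k ↦ expMod ((p : ℕ) ^ k) (pow_ne_zero k p.2.ne_zero))
      fun _ _ h ↦ expMod_compat _ _ _ _ (pow_dvd_pow (p : ℕ) h)

/-- If `a` is the image of `χ`, then `χ(ζ) = ζ ^ a` for all roots of unity `ζ` of prime power order
(and these generate `μ_∞`). -/
lemma HDot.apply_eq_pow (χ : HDot) (p : Nat.Primes) (k : ℕ) (ζ : MuInf) (hζ : ζ ^ (p : ℕ) ^ k = 1) :
    (χ (.ofMul ζ)).toMul = ζ ^ (PadicInt.toZModPow k (χ.toZHat p)).val := by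
  have h := RingHom.congr_fun (PadicInt.lift_spec
    (f := fun k ↦ expMod ((p : ℕ) ^ k) (pow_ne_zero k p.2.ne_zero))
    (fun _ _ h ↦ expMod_compat _ _ _ _ (pow_dvd_pow (p : ℕ) h)) k) χ
  refine (expModFun_spec ((p : ℕ) ^ k) (pow_ne_zero k p.2.ne_zero) χ ζ hζ).trans ?_
  exact congrArg (fun z : ZMod ((p : ℕ) ^ k) ↦ ζ ^ z.val) h.symm

/-- A multiplicative map `μ_∞ → ℂ` that sends `1` to `1` has values in `μ_∞`. -/
def HDot.ofHom (φ : MuInf →* ℂ) : HDot :=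
  MonoidHom.toAdditive (φ.toHomUnits.codRestrict (CommGroup.torsion ℂˣ) fun ζ ↦
    MonoidHom.isOfFinOrder φ.toHomUnits (Submonoid.isOfFinOrder_coe.mp ζ.2))

lemma HDot.ofHom_apply (φ : MuInf →* ℂ) (ζ : MuInf) :
    (((HDot.ofHom φ (.ofMul ζ)).toMul : ℂˣ) : ℂ) = φ ζ := rfl

lemma HDot.ext_complex {χ χ' : HDot} (h : ∀ ζ : MuInf,
    (((χ (.ofMul ζ)).toMul : ℂˣ) : ℂ) = (((χ' (.ofMul ζ)).toMul : ℂˣ) : ℂ)) : χ = χ' :=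
  AddMonoidHom.ext fun ζ ↦ Additive.toMul.injective (Subtype.ext (Units.ext (h ζ.toMul)))

/-- The inclusion `ℚ^ab ⊂ ℂ`. -/
def Qab.toComplex : Qab →+* ℂ := (algebraMap Qbar ℂ).comp (algebraMap Qab Qbar)

/-- Every root of unity is an algebraic integer of `ℚ^ab`. -/
lemma exists_intEmb (ζ : MuInf) : ∃ z : 𝓞 Qab, Qab.toComplex z = (ζ.1 : ℂ) := by
  have hfin : IsOfFinOrder (ζ.1 : ℂˣ) := ζ.2
  set n := orderOf (ζ.1 : ℂˣ) with hn
  have hpos : 0 < n := hfin.orderOf_pos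
  have : NeZero n := ⟨hpos.ne'⟩
  have hprim : IsPrimitiveRoot ((ζ.1 : ℂˣ) : ℂ) n :=
    IsPrimitiveRoot.coe_units_iff.mpr (IsPrimitiveRoot.orderOf _)
  have hint : IsIntegral ℤ ((ζ.1 : ℂˣ) : ℂ) := hprim.isIntegral hpos
  have halg : ((ζ.1 : ℂˣ) : ℂ) ∈ algebraicClosure ℚ ℂ :=
    mem_algebraicClosure_iff.mpr hint.tower_top.isAlgebraic
  let z : Qbar := ⟨_, halg⟩
  have hz : IsPrimitiveRoot z n := IsPrimitiveRoot.coe_submonoidClass_iff.mp hprim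
  have : Algebra.IsIntegral ℚ Qbar :=
    (algebraicClosure.isAlgebraic ℚ ℂ).isIntegral
  have hc : IsCyclotomicExtension {n} ℚ (IntermediateField.adjoin ℚ {z}) :=
    hz.intermediateField_adjoin_isCyclotomicExtension ℚ
  have hab : IsAbelianGalois ℚ (IntermediateField.adjoin ℚ {z}) :=
    @IsCyclotomicExtension.isAbelianGalois {n} ℚ _ _ _ _ hc
  have hmem : z ∈ maxAbelian :=
    (le_sSup (a := IntermediateField.adjoin ℚ {z}) hab : _ ≤ maxAbelian)
      (IntermediateField.mem_adjoin_simple_self ℚ z)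
  have hz' : IsPrimitiveRoot (⟨z, hmem⟩ : Qab) n := IsPrimitiveRoot.coe_submonoidClass_iff.mp hz
  exact ⟨⟨⟨z, hmem⟩, hz'.isIntegral hpos⟩, rfl⟩

lemma intEmb_injective : Function.Injective fun z : 𝓞 Qab ↦ Qab.toComplex z :=
  Qab.toComplex.injective.comp RingOfIntegers.coe_injective

/-- The inclusion `μ_∞ ⊂ 𝓞_{ℚ^ab}`. -/
def intEmb : MuInf →* 𝓞 Qab where
  toFun ζ := (exists_intEmb ζ).choose
  map_one' := intEmb_injective (by
    simp only [(exists_intEmb 1).choose_spec, map_one]; rfl)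
  map_mul' ζ ξ := intEmb_injective (by
    simp only [(exists_intEmb (ζ * ξ)).choose_spec, map_mul, (exists_intEmb ζ).choose_spec,
      (exists_intEmb ξ).choose_spec]; rfl)

lemma toComplex_intEmb (ζ : MuInf) : Qab.toComplex (intEmb ζ) = (ζ.1 : ℂ) :=
  (exists_intEmb ζ).choose_spec

/-- The action of `Gal(ℚ^ab/ℚ)` on `μ_∞`. -/
def galChar : Gal(Qab/ℚ) →* HDot where
  toFun σ := HDot.ofHom (((Qab.toComplex.comp (σ : Qab →+* Qab)).comp
    (algebraMap (𝓞 Qab) Qab)).toMonoidHom.comp intEmb)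
  map_one' := HDot.ext_complex fun ζ ↦ toComplex_intEmb ζ
  map_mul' σ τ := HDot.ext_complex fun ζ ↦ by
    let ρ : Gal(Qab/ℚ) → HDot := fun σ ↦ HDot.ofHom (((Qab.toComplex.comp (σ : Qab →+* Qab)).comp
      (algebraMap (𝓞 Qab) Qab)).toMonoidHom.comp intEmb)
    have h : ∀ (σ : Gal(Qab/ℚ)) (ζ : MuInf),
        (((ρ σ (.ofMul ζ)).toMul : ℂˣ) : ℂ) = Qab.toComplex (σ (intEmb ζ : Qab)) := fun _ _ ↦ rfl
    have e : (intEmb (ρ τ (.ofMul ζ)).toMul : Qab) = τ (intEmb ζ : Qab) :=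
      Qab.toComplex.injective ((toComplex_intEmb _).trans (h τ ζ))
    change Qab.toComplex (σ (τ (intEmb ζ : Qab))) = (((ρ σ (ρ τ (.ofMul ζ))).toMul : ℂˣ) : ℂ)
    rw [← e]
    rfl

/-- The cyclotomic character `Gal(ℚ^ab/ℚ) → (∏_p ℤ_p)ˣ`, with `σ(ζ) = ζ ^ cycl(σ)`. -/
def cycl : Gal(Qab/ℚ) →* ZHatˣ :=
  (Units.map (HDot.toZHat : HDot →* ZHat)).comp galChar.toHomUnits

/-! ### Adelic spaces -/

/-- The finite adeles of `ℚ`. -/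
abbrev FinAdele : Type := FiniteAdeleRing (𝓞 ℚ) ℚ

/-- The adeles `𝔸 = 𝔸^f × ℝ` of `ℚ`. -/
abbrev Adele : Type := FinAdele × ℝ

/-- The inclusion `∏_p ℤ_p ⊂ 𝔸^f`, where `ℤ_p` is identified with the integers of the completion of
`ℚ` at `p`. -/
def ZHat.toFinAdele : ZHat →+* FinAdele where
  toFun a := ⟨fun v ↦
      ((Rat.HeightOneSpectrum.adicCompletionIntegers.padicIntEquiv v).symm
        (a (Rat.HeightOneSpectrum.primesEquiv v)) : v.adicCompletionIntegers ℚ),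
    Filter.Eventually.of_forall fun _ ↦ Subtype.property _⟩
  map_one' := FiniteAdeleRing.ext ℚ fun _ ↦ congrArg Subtype.val (map_one _)
  map_mul' _ _ := FiniteAdeleRing.ext ℚ fun _ ↦ congrArg Subtype.val (map_mul _ _ _)
  map_zero' := FiniteAdeleRing.ext ℚ fun _ ↦ congrArg Subtype.val (map_zero _)
  map_add' _ _ := FiniteAdeleRing.ext ℚ fun _ ↦ congrArg Subtype.val (map_add _ _ _)

/-- The adelic space `ℚˣ \ 𝔸 / U`, with the quotient topology. -/
def AdelicSpace (U : Subgroup ZHatˣ) : Type :=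
  Quot fun a b : Adele ↦
    ∃ q : ℚˣ, ∃ u ∈ U, b = algebraMap ℚ Adele q * a * (ZHat.toFinAdele (u : ZHatˣ), 1)

namespace AdelicSpace

instance (U : Subgroup ZHatˣ) : TopologicalSpace (AdelicSpace U) :=
  inferInstanceAs (TopologicalSpace (Quot _))

/-- The class of an adele. -/
def mk {U : Subgroup ZHatˣ} (a : Adele) : AdelicSpace U := Quot.mk _ a

/-- The natural map `ℚˣ \ 𝔸 / U → ℚˣ \ 𝔸 / V` for `U ≤ V`. -/
def proj {U V : Subgroup ZHatˣ} (h : U ≤ V) : AdelicSpace U → AdelicSpace V :=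
  Quot.map id fun _ _ ⟨q, u, hu, e⟩ ↦ ⟨q, u, h hu, e⟩

/-- The action of `ℝ_+` by multiplication on the infinite component. -/
def flow {U : Subgroup ZHatˣ} (t : PosReal) : AdelicSpace U → AdelicSpace U :=
  Quot.map (fun a ↦ a * (1, (t : ℝ))) fun _ _ ⟨q, u, hu, e⟩ ↦
    ⟨q, u, hu, by rw [e]; ring⟩

/-- Multiplication by a unit of `∏_p ℤ_p` on the finite components. -/
def mulUnit {U : Subgroup ZHatˣ} (z : ZHatˣ) : AdelicSpace U → AdelicSpace U :=
  Quot.map (fun a ↦ a * (ZHat.toFinAdele z, 1)) fun _ _ ⟨q, u, hu, e⟩ ↦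
    ⟨q, u, hu, by rw [e]; ring⟩

end AdelicSpace

/-- The adele class space `ℚˣ \ 𝔸`. -/
abbrev AdeleClassSpace : Type := AdelicSpace ⊥

/-- The action of `Gal(ℚ^ab/ℚ)` on the adele class space. -/
def AdeleClassSpace.galAct (σ : Gal(Qab/ℚ)) : AdeleClassSpace → AdeleClassSpace :=
  AdelicSpace.mulUnit (cycl σ)

/-- The adelic space `ℚˣ \ 𝔸 / U_F` of a subextension `F` of `ℚ^ab`, where `U_F` is the subgroup
of `(∏_p ℤ_p)ˣ` corresponding to `Gal(ℚ^ab/F)`. -/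
abbrev CCSpace (F : IntermediateField ℚ Qab) : Type :=
  AdelicSpace (F.fixingSubgroup.map cycl)

namespace CCSpace

/-- The natural covering `φ_{ℚ^ab/F}`. -/
def proj (F : IntermediateField ℚ Qab) : AdeleClassSpace → CCSpace F := AdelicSpace.proj bot_le

/-- The action of `g` in `Gal(F/ℚ)`: multiplication by an extension of `g` to `ℚ^ab`. -/
def galAct {F : IntermediateField ℚ Qab} (g : Gal(F/ℚ)) : CCSpace F → CCSpace F :=
  AdelicSpace.mulUnit (cycl (g.liftNormal Qab))

end CCSpace

/-! ### The map `Ψ` -/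

/-- The character `P|_{μ_∞} ∘ ι_𝔓` of a point `(𝔓, P)`, where `ι_𝔓` is reduction modulo `𝔓`: it
sends `ζ` to `P([ζ mod 𝔓])`. -/
def XDot.char (x : XDot Qab) : HDot := HDot.ofHom (x.mulMap.comp intEmb)

/-- The map `ψ`, with values in `∏_p ℤ_p ≅ Hom(μ_∞, μ_∞)`. -/
def XDot.psi (x : XDot Qab) : ZHat := x.char.toZHat

lemma XDot.mulMap_frob {K : Type*} [Field K] (n : ℕ+) (x : XDot K) (a : 𝓞 K) :
    (x.frob n).mulMap a = x.mulMap a ^ (n : ℕ) := by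
  have h : ∀ b : x.prime.asIdeal.ResidueField,
      x.hom (WRat.frob _ n (WRat.teich _ b)) = x.hom (WRat.teich _ b) ^ (n : ℕ) := fun b ↦ by
    rw [WRat.frob_teich, map_pow, map_pow]
  exact h _

lemma XDot.char_frob (n : ℕ+) (x : XDot Qab) : (x.frob n).char = (n : ℕ) • x.char :=
  HDot.ext_complex fun ζ ↦ x.mulMap_frob n (intEmb ζ)

lemma XDot.psi_frob (n : ℕ+) (x : XDot Qab) : (x.frob n).psi = (n : ℕ) • x.psi := by
  rw [psi, char_frob, map_nsmul]; rfl

lemma XDot.toFinAdele_psi_frob (n : ℕ+) (x : XDot Qab) : ZHat.toFinAdele (x.frob n).psi =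
    algebraMap ℚ FinAdele (n : ℚ) * ZHat.toFinAdele x.psi := by
  have h : algebraMap ℚ FinAdele ((n : ℕ) : ℚ) = ((n : ℕ) : FinAdele) := map_natCast _ _
  rw [psi_frob, map_nsmul, nsmul_eq_mul, ← h]

/-- The extension of `ψ` to the inductive limit, `F_n⁻¹ x ↦ ψ(x) / n`. -/
def XCheck.psi : XCheck Qab → FinAdele :=
  Quotient.lift (fun x ↦ algebraMap ℚ FinAdele ((x.1 : ℚ)⁻¹) * ZHat.toFinAdele x.2.psi) (by
    rintro ⟨n, x⟩ ⟨m, y⟩ ⟨a, b, h, h'⟩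
    dsimp only at h h' ⊢
    have e := congrArg (fun z : XDot Qab ↦ ZHat.toFinAdele z.psi) h'
    simp only [XDot.toFinAdele_psi_frob] at e
    have hq : (n : ℚ) * a = m * b := by exact_mod_cast congrArg PNat.val h
    have ha : (a : ℚ) ≠ 0 := by exact_mod_cast a.ne_zero
    have hb : (b : ℚ) ≠ 0 := by exact_mod_cast b.ne_zero
    have hn : (n : ℚ) ≠ 0 := by exact_mod_cast n.ne_zero
    have hm : (m : ℚ) ≠ 0 := by exact_mod_cast m.ne_zero
    have h1 : (n : ℚ)⁻¹ = ((n : ℚ) * a)⁻¹ * a := by field_simp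
    have h2 : (m : ℚ)⁻¹ = ((n : ℚ) * a)⁻¹ * b := by rw [hq]; field_simp
    rw [h1, h2, map_mul, map_mul, mul_assoc, mul_assoc, e])

lemma XCheck.psi_frob (q : PosRat) (x : XCheck Qab) :
    (x.frob q).psi = algebraMap ℚ FinAdele q.1 * x.psi := by
  induction x using Quotient.inductionOn with
  | h x =>
    change algebraMap ℚ FinAdele (((x.1 * q.den : ℕ+) : ℚ)⁻¹) * ZHat.toFinAdele (x.2.frob q.num).psi =
      algebraMap ℚ FinAdele q.1 * (algebraMap ℚ FinAdele ((x.1 : ℚ)⁻¹) * ZHat.toFinAdele x.2.psi)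
    have hq : q.1 = (q.num : ℚ) / (q.den : ℚ) := by
      have h1 : ((q.num : ℕ) : ℤ) = q.1.num := Int.toNat_of_nonneg (Rat.num_nonneg.mpr q.2.le)
      have h2 : ((q.num : ℕ) : ℚ) = (q.1.num : ℚ) := by exact_mod_cast congrArg (Int.cast (R := ℚ)) h1
      rw [h2]
      exact (Rat.num_div_den q.1).symm
    rw [XDot.toFinAdele_psi_frob, ← mul_assoc, ← mul_assoc, ← map_mul, ← map_mul]
    refine congrArg (fun r : ℚ ↦ algebraMap ℚ FinAdele r * ZHat.toFinAdele x.2.psi) ?_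
    rw [hq, PNat.mul_coe, Nat.cast_mul, mul_inv]
    ring

/-- The space `𝔸^f ×_{ℚ_+} ℝ_+`: the quotient of `𝔸^f × ℝ_+` by the action
`(a, u) ↦ (q a, q⁻¹ u)` of `ℚ_+`. -/
def TwistedAdele : Type :=
  Quot fun x y : FinAdele × PosReal ↦
    ∃ q : PosRat, y = (algebraMap ℚ FinAdele q.1 * x.1, q.toReal⁻¹ * x.2)

/-- The map `𝔛_{ℚ^ab} → 𝔸^f ×_{ℚ_+} ℝ_+`, `[x, u] ↦ [ψ(x), u]`. -/
def XFrak.psi : XFrak Qab → TwistedAdele :=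
  Quot.map (fun x ↦ (x.1.psi, x.2)) (by
    rintro x _ ⟨q, rfl⟩
    exact ⟨q, by rw [XCheck.psi_frob]⟩)

/-- The map `τ : 𝔸^f ×_{ℚ_+} ℝ_+ → ℚˣ \ 𝔸`, `[a, u] ↦ [(a, u⁻¹)]`. -/
def TwistedAdele.tau : TwistedAdele → AdeleClassSpace :=
  Quot.map (fun x ↦ (x.1, ((x.2⁻¹ : PosReal) : ℝ))) (by
    rintro x _ ⟨q, rfl⟩
    refine ⟨Units.mk0 q.1 q.2.ne', 1, Subgroup.one_mem _, ?_⟩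
    refine Prod.ext ?_ ?_
    · simp
    · simp [PosRat.toReal, mul_comm])

/-- The map `Ψ_{ℚ^ab} : 𝔛_{ℚ^ab} → ℚˣ \ 𝔸`. -/
def Psi (x : XFrak Qab) : AdeleClassSpace := x.psi.tau

end

/-!
Let `x = (𝔓, P)` and `y = (𝔔, Q)` in `Ẋ_{ℚ^ab}` have the same image in `Ẋ_F`. For an algebraic
integer `b` of `ℚ^ab` the polynomial `∏ (X - [c])` over the conjugates `c` of `b` over `F` has
coefficients in `W_rat(𝓞_F)`: its elementary symmetric functions are sums of Teichmüller elements of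
a Galois-stable family. Hence `P` and `Q` give it the same image, and comparing roots,
`Q[b] = P[σ b]` for some `σ` in `Gal(ℚ^ab/F)`. By compactness of the Galois group a single `σ` works
for all roots of unity, that is, `ψ(y) = ψ(x) cycl(σ)`, so `Ψ` descends to `𝔛_F`.

The same polynomials show that `W_rat` turns algebraic field extensions into integral ring
extensions, so that homomorphisms to `ℂ` extend and the projections are surjective. For continuity,
`P[ζ]` takes only finitely many values when `ζⁿ = 1`, which makes `ψ` modulo `pᵏ` locally constant.
Continuity passes to `Ψ_F` because `𝔛_{ℚ^ab} → 𝔛_F` is a quotient map, `ℝ_+` being locally compact.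
-/

section SymmetricFunctions

variable {R S : Type*} [CommRing R] [CommRing S]

lemma multiset_prod_X_sub_C_mem_lifts_iff {φ : R →+* S} {s : Multiset S} :
    (s.map fun b ↦ X - C b).prod ∈ lifts φ ↔ ∀ k, s.esymm k ∈ φ.range := by
  refine ⟨fun h k ↦ ?_, fun h ↦ ?_⟩
  · rcases le_or_gt k s.card with hk | hk
    · obtain ⟨r, hr⟩ := (lifts_iff_coeff_lifts _).mp h (s.card - k)
      rw [Multiset.prod_X_sub_C_coeff s (Nat.sub_le _ _), Nat.sub_sub_self hk] at hr
      refine ⟨(-1) ^ k * r, ?_⟩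
      rw [map_mul, hr, map_pow, map_neg, map_one, ← mul_assoc, ← mul_pow, neg_one_mul, neg_neg,
        one_pow, one_mul]
    · rw [Multiset.esymm, Multiset.powersetCard_eq_empty k hk]
      exact φ.range.zero_mem
  · rw [Multiset.prod_X_sub_X_eq_sum_esymm]
    refine sum_mem fun k _ ↦ mul_mem (pow_mem ((mem_lifts _).mpr ⟨-1, by simp⟩) _)
      (mul_mem ?_ (X_pow_mem_lifts φ _))
    obtain ⟨r, hr⟩ := h k
    exact (mem_lifts _).mpr ⟨C r, by rw [map_C, hr]⟩

lemma aeval_mem_range_of_isSymmetric [Algebra R S] {ι : Type*} [Fintype ι] {a : ι → S}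
    (ha : (∏ i, (X - C (a i))) ∈ lifts (algebraMap R S)) {p : MvPolynomial ι R}
    (hp : p.IsSymmetric) : MvPolynomial.aeval a p ∈ (algebraMap R S).range := by
  have hesymm (k : ℕ) :
      MvPolynomial.aeval a (MvPolynomial.esymm ι R k) ∈ (algebraMap R S).range := by
    rw [MvPolynomial.aeval_esymm_eq_multiset_esymm]
    refine multiset_prod_X_sub_C_mem_lifts_iff.mp ?_ k
    rwa [Multiset.map_map]
  obtain ⟨q, hq⟩ := MvPolynomial.esymmAlgHom_surjective (R := R) (σ := ι) le_rfl ⟨p, hp⟩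
  choose r hr using hesymm
  refine ⟨MvPolynomial.aeval (fun i : Fin (Fintype.card ι) ↦ r (i + 1)) q, ?_⟩
  obtain rfl := congrArg Subtype.val hq
  rw [MvPolynomial.esymmAlgHom_apply, ← MvPolynomial.aeval_algebraMap_apply,
    MvPolynomial.comp_aeval_apply]
  simp only [Function.comp_def, hr]

lemma prod_powersetCard_mem_lifts {φ : R →+* S} {ι : Type*} [Fintype ι] {a : ι → S}
    (ha : (∏ i, (X - C (a i))) ∈ lifts φ) (j : ℕ) :
    (∏ T ∈ Finset.univ.powersetCard j, (1 - C (∏ i ∈ T, a i) * X : S[X])) ∈ lifts φ := by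
  let _ : Algebra R S := φ.toAlgebra
  let Q : (MvPolynomial ι R)[X] :=
    ∏ T ∈ Finset.univ.powersetCard j, (1 - C (∏ i ∈ T, MvPolynomial.X i) * X)
  have hQ_symm (k : ℕ) : (Q.coeff k).IsSymmetric := fun e ↦ by
    have hQe : Q.map (MvPolynomial.rename (R := R) e : MvPolynomial ι R →+* _) = Q := by
      simp only [Q, Polynomial.map_prod, Polynomial.map_sub, Polynomial.map_one,
        Polynomial.map_mul, map_C, map_X, map_prod, RingHom.coe_coe, MvPolynomial.rename_X]
      refine Finset.prod_equiv e.finsetCongr (fun T ↦ ?_) fun T _ ↦ ?_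
      · simp [Finset.mem_powersetCard]
      · simp
    conv_rhs => rw [← hQe]
    rw [coeff_map]
    rfl
  have hQ_map : Q.map (MvPolynomial.aeval (R := R) a : MvPolynomial ι R →+* S) =
      ∏ T ∈ Finset.univ.powersetCard j, (1 - C (∏ i ∈ T, a i) * X) := by
    simp [Q, Polynomial.map_prod]
  rw [← hQ_map, lifts_iff_coeff_lifts]
  intro k
  rw [coeff_map]
  exact aeval_mem_range_of_isSymmetric ha (hQ_symm k)

end SymmetricFunctions

namespace WRat

section CommRing

variable {R S T A : Type*} [CommRing R] [CommRing S] [CommRing T] [CommRing A]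

lemma of_mem_range_mapHom {φ : R →+* S} {p : Additive (onePoly S)} (hp : p.toMul.1 ∈ lifts φ) :
    of p ∈ (mapHom φ).range := by
  obtain ⟨r, hr⟩ := (mem_lifts _).mp hp
  have h0 : φ (r.coeff 0) = 1 := by
    rw [← coeff_map, hr]
    exact p.toMul.2
  have hr1 : (r - C (r.coeff 0 - 1)).coeff 0 = 1 := by simp
  refine ⟨of (.ofMul ⟨_, hr1⟩), (mapHom_of φ _).trans (congrArg of (Additive.toMul.injective
    (Subtype.ext ?_)))⟩
  change (r - C (r.coeff 0 - 1)).map φ = p.toMul.1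
  simp [h0, hr]

lemma sum_teich {ι : Type*} (s : Finset ι) (b : ι → R) :
    ∑ i ∈ s, teich R (b i) = of (.ofMul ⟨∏ i ∈ s, (1 - C (b i) * X),
      Submonoid.prod_mem _ fun i _ ↦ lin_coeff_zero (b i)⟩) := by
  refine (map_sum of (fun i ↦ linPoly (b i)) s).symm.trans
    (congrArg of (Additive.toMul.injective (Subtype.ext ?_)))
  rw [toMul_sum, Submonoid.coe_finsetProd]
  rfl

lemma prod_X_sub_C_teich_mem_lifts {φ : R →+* S} {s : Multiset S}
    (hs : (s.map fun b ↦ X - C b).prod ∈ lifts φ) :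
    (s.map fun b ↦ X - C (teich S b)).prod ∈ lifts (mapHom φ) := by
  obtain ⟨n, a, rfl⟩ : ∃ n, ∃ a : Fin n → S, s = Finset.univ.val.map a := by
    induction s using Quotient.inductionOn with
    | h l => exact ⟨l.length, l.get, by simp⟩
  have key (j : ℕ) : ((Finset.univ.val.map a).map (teich S)).esymm j ∈ (mapHom φ).range := by
    rw [Multiset.map_map, Finset.esymm_map_val]
    simp only [Function.comp_apply, ← map_prod]
    rw [sum_teich]
    exact of_mem_range_mapHom (prod_powersetCard_mem_lifts (by rwa [Multiset.map_map] at hs) j)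
  simpa only [Multiset.map_map, Function.comp_def] using
    multiset_prod_X_sub_C_mem_lifts_iff.mpr key

lemma map_teich_eq_map_teich [IsDomain A] {φ : R →+* S} {s : Multiset S}
    (hs : (s.map fun b ↦ X - C b).prod ∈ lifts φ) {P Q : WRat S →+* A}
    (hPQ : P.comp (mapHom φ) = Q.comp (mapHom φ)) :
    s.map (fun b ↦ P (teich S b)) = s.map fun b ↦ Q (teich S b) := by
  obtain ⟨g, hg⟩ := (mem_lifts _).mp (prod_X_sub_C_teich_mem_lifts hs)
  have hmap (P : WRat S →+* A) :
      g.map (P.comp (mapHom φ)) = ((s.map fun b ↦ P (teich S b)).map fun b ↦ X - C b).prod := by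
    rw [← Polynomial.map_map, hg, ← coe_mapRingHom, map_multiset_prod, Multiset.map_map,
      Multiset.map_map]
    simp
  rw [← roots_multiset_prod_X_sub_C (s.map fun b ↦ P (teich S b)), ← hmap, hPQ, hmap,
    roots_multiset_prod_X_sub_C]

lemma isIntegralElem_teich {φ : R →+* S} {s : Multiset S}
    (hs : (s.map fun b ↦ X - C b).prod ∈ lifts φ) {a : S} (ha : a ∈ s) :
    (mapHom φ).IsIntegralElem (teich S a) := by
  obtain ⟨g, hgs, -, hg⟩ := lifts_and_natDegree_eq_and_monic (prod_X_sub_C_teich_mem_lifts hs)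
    (monic_multiset_prod_of_monic _ _ fun b _ ↦ monic_X_sub_C _)
  refine ⟨g, hg, ?_⟩
  rw [← eval_map, hgs, eval_multiset_prod, Multiset.map_map]
  exact Multiset.prod_eq_zero (Multiset.mem_map.mpr ⟨a, ha, by simp⟩)

lemma exists_add_of_eq (x : WRat R) : ∃ p q : Additive (onePoly R), x + of q = of p := by
  obtain ⟨y, hy⟩ := (AddLocalization.addMonoidOf (⊤ : AddSubmonoid (Additive (onePoly R)))).surj x
  exact ⟨y.1, y.2, hy⟩

lemma of_injective [IsDomain R] : Function.Injective (of : Additive (onePoly R) →+ WRat R) := by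
  have hne (p : onePoly R) : p.1 ≠ 0 := fun h0 ↦ by
    have h1 : p.1.coeff 0 = 1 := p.2
    rw [h0, coeff_zero] at h1
    exact zero_ne_one h1
  have : IsCancelMul (onePoly R) :=
    { mul_left_cancel p _ _ h := Subtype.ext (mul_left_cancel₀ (hne p) (congrArg Subtype.val h))
      mul_right_cancel p _ _ h := Subtype.ext (mul_right_cancel₀ (hne p) (congrArg Subtype.val h)) }
  exact Algebra.GrothendieckAddGroup.of_injective

lemma mapHom_injective [IsDomain S] {f : R →+* S} (hf : Function.Injective f) :
    Function.Injective (mapHom f) := by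
  rw [injective_iff_map_eq_zero]
  intro x hx
  obtain ⟨p, q, h⟩ := exists_add_of_eq x
  have e := congrArg (mapHom f) h
  rw [map_add, hx, zero_add, mapHom_of, mapHom_of] at e
  have hqp : q = p := Additive.toMul.injective (Subtype.ext (map_injective f hf
    (congrArg (fun z : Additive (onePoly S) ↦ z.toMul.1) (of_injective e))))
  rwa [hqp, add_eq_right] at h

lemma mapHom_comp (g : S →+* T) (f : R →+* S) :
    (mapHom g).comp (mapHom f) = mapHom (g.comp f) :=
  ringHom_ext fun p ↦ by
    rw [RingHom.comp_apply, mapHom_of, mapHom_of, mapHom_of]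
    exact congrArg of (congrArg Additive.ofMul (Subtype.ext (Polynomial.map_map _ _ _)))

end CommRing

lemma closure_range_teich (K : Type*) [Field K] [IsAlgClosed K] :
    AddSubgroup.closure (Set.range (teich K)) = ⊤ := by
  have hof : ∀ (p : K[X]) (hp : p.coeff 0 = 1),
      of (.ofMul ⟨p, hp⟩) ∈ AddSubgroup.closure (Set.range (teich K)) := by
    intro p hp
    induction p, hp using split_induction with
    | one => exact (map_zero of : of (.ofMul (1 : onePoly K)) = 0) ▸ AddSubgroup.zero_mem _
    | step a p hp ih =>
      have hadd : (of (.ofMul ⟨(1 - C a * X) * p, (onePoly K).mul_mem (lin_coeff_zero a) hp⟩) :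
          WRat K) = teich K a + of (.ofMul ⟨p, hp⟩) := map_add of (linPoly a) (.ofMul ⟨p, hp⟩)
      exact hadd ▸ AddSubgroup.add_mem _ (AddSubgroup.subset_closure ⟨a, rfl⟩) ih
  refine eq_top_iff.mpr fun x _ ↦ ?_
  obtain ⟨p, q, e⟩ := exists_add_of_eq x
  rw [eq_sub_of_add_eq e]
  exact AddSubgroup.sub_mem _ (hof _ p.toMul.2) (hof _ q.toMul.2)

lemma mapHom_algebraMap_isIntegral (k Ω : Type*) [Field k] [Field Ω] [Algebra k Ω]
    [Algebra.IsAlgebraic k Ω] [IsAlgClosed Ω] : (mapHom (algebraMap k Ω)).IsIntegral := by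
  let _ : Algebra (WRat k) (WRat Ω) := (mapHom (algebraMap k Ω)).toAlgebra
  have hteich : Set.range (teich Ω) ⊆ (integralClosure (WRat k) (WRat Ω)).toSubring := by
    rintro _ ⟨a, rfl⟩
    have ha : IsIntegral k a := Algebra.IsIntegral.isIntegral a
    have hmonic := (minpoly.monic ha).map (algebraMap k Ω)
    refine isIntegralElem_teich (s := ((minpoly k a).map (algebraMap k Ω)).roots) ?_ ?_
    · rw [← (IsAlgClosed.splits _).eq_prod_roots_of_monic hmonic]
      exact (mem_lifts _).mpr ⟨_, rfl⟩
    · rw [mem_roots hmonic.ne_zero, IsRoot, eval_map_algebraMap, minpoly.aeval]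
  intro x
  have hx : x ∈ AddSubgroup.closure (Set.range (teich Ω)) :=
    closure_range_teich Ω ▸ AddSubgroup.mem_top x
  exact (AddSubgroup.closure_le (K :=
    (integralClosure (WRat k) (WRat Ω)).toSubring.toAddSubgroup)).mpr hteich hx

end WRat

lemma exists_ringHom_comp_eq_of_isIntegral {A B L : Type*} [CommRing A] [CommRing B] [Field L]
    [IsAlgClosed L] {f : A →+* B} (hf : f.IsIntegral) (hinj : Function.Injective f)
    (P : A →+* L) : ∃ Q : B →+* L, Q.comp f = P := by
  let _ : Algebra A B := f.toAlgebra
  have : Algebra.IsIntegral A B := ⟨hf⟩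
  have : FaithfulSMul A B := (faithfulSMul_iff_algebraMap_injective A B).mpr hinj
  have : (RingHom.ker P).IsPrime := RingHom.ker_isPrime P
  obtain ⟨q, hq⟩ := Algebra.IsIntegral.comap_surjective A B ⟨RingHom.ker P, this⟩
  have : q.asIdeal.LiesOver (RingHom.ker P) := ⟨congrArg PrimeSpectrum.asIdeal hq.symm⟩
  let _ := Localization.AtPrime.algebraOfLiesOver (RingHom.ker P) q.asIdeal
  let _ : Algebra (RingHom.ker P).ResidueField L :=
    (Ideal.ResidueField.lift (RingHom.ker P) P le_rfl fun _ ha ↦ Ne.isUnit ha).toAlgebra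
  let ψ : q.asIdeal.ResidueField →ₐ[(RingHom.ker P).ResidueField] L := IsAlgClosed.lift
  refine ⟨(ψ : q.asIdeal.ResidueField →+* L).comp (algebraMap B _), RingHom.ext fun a ↦ ?_⟩
  exact (congrArg ψ (IsScalarTower.algebraMap_apply A (RingHom.ker P).ResidueField
    q.asIdeal.ResidueField a)).trans ((ψ.commutes _).trans (Ideal.ResidueField.lift_algebraMap ..))

lemma WRat.exists_comp_mapHom_eq {k l L : Type*} [Field k] [Field l] [Field L] [IsAlgClosed L]
    {f : k →+* l} (hf : f.IsIntegral) (P : WRat k →+* L) :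
    ∃ Q : WRat l →+* L, Q.comp (WRat.mapHom f) = P := by
  let _ : Algebra k l := f.toAlgebra
  have : Algebra.IsIntegral k l := ⟨hf⟩
  have : Algebra.IsAlgebraic k (AlgebraicClosure l) := .trans k l _
  obtain ⟨Q, hQ⟩ := exists_ringHom_comp_eq_of_isIntegral
    (WRat.mapHom_algebraMap_isIntegral k (AlgebraicClosure l))
    (WRat.mapHom_injective (algebraMap k (AlgebraicClosure l)).injective) P
  refine ⟨Q.comp (WRat.mapHom (algebraMap l _)), ?_⟩
  rw [RingHom.comp_assoc, WRat.mapHom_comp, ← hQ]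
  rfl

noncomputable section

open NumberField IsDedekindDomain Topology

lemma isIntegral_residueFieldMap {A B : Type*} [CommRing A] [CommRing B] {f : A →+* B}
    (hf : f.IsIntegral) (I : Ideal A) [I.IsPrime] (J : Ideal B) [J.IsPrime] (h : I = J.comap f) :
    (Ideal.ResidueField.map I J f h).IsIntegral := by
  let _ : Algebra A B := f.toAlgebra
  have : Algebra.IsIntegral A B := ⟨hf⟩
  have : J.LiesOver I := ⟨h⟩
  let _ := Localization.AtPrime.algebraOfLiesOver I J
  exact (inferInstance : Algebra.IsAlgebraic I.ResidueField J.ResidueField).isIntegral.1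

lemma residueFieldMap_comp {A B C : Type*} [CommRing A] [CommRing B] [CommRing C] {f : A →+* B}
    {g : B →+* C} {I : Ideal A} [I.IsPrime] {J : Ideal B} [J.IsPrime] {K : Ideal C} [K.IsPrime]
    (hf : I = J.comap f) (hg : J = K.comap g) (hgf : I = K.comap (g.comp f)) :
    (Ideal.ResidueField.map J K g hg).comp (Ideal.ResidueField.map I J f hf) =
      Ideal.ResidueField.map I K (g.comp f) hgf :=
  Ideal.ResidueField.ringHom_ext <| RingHom.ext fun a ↦ by
    simp only [RingHom.comp_apply, Ideal.ResidueField.map_algebraMap]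

namespace XDot

variable {K L M : Type*} [Field K] [Field L] [Field M]

lemma pull_pull (f : K →+* L) (g : L →+* M) (x : XDot M) :
    pull f (pull g x) = pull (g.comp f) x :=
  congrArg (XDot.mk _) ((RingHom.comp_assoc _ _ _).trans (congrArg x.hom.comp
    ((WRat.mapHom_comp _ _).trans (congrArg WRat.mapHom (residueFieldMap_comp rfl rfl rfl)))))

/-- The homomorphism `W_rat(𝓞_K) → W_rat(κ(𝔭)) → ℂ` of a point `(𝔭, P)`, which allows points at
different primes to be compared. -/
def intHom (x : XDot K) : WRat (𝓞 K) →+* ℂ :=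
  x.hom.comp (WRat.mapHom (algebraMap (𝓞 K) x.prime.asIdeal.ResidueField))

lemma intHom_teich (x : XDot K) (a : 𝓞 K) : x.intHom (WRat.teich _ a) = x.mulMap a :=
  congrArg x.hom (WRat.mapHom_teich _ a)

lemma intHom_pull (f : K →+* L) (x : XDot L) :
    (pull f x).intHom = x.intHom.comp (WRat.mapHom (RingOfIntegers.mapRingHom f)) := by
  refine (RingHom.comp_assoc _ _ _).trans (Eq.trans ?_ (RingHom.comp_assoc _ _ _).symm)
  refine congrArg x.hom.comp
    ((WRat.mapHom_comp _ _).trans (Eq.trans ?_ (WRat.mapHom_comp _ _).symm))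
  exact congrArg WRat.mapHom (RingHom.ext fun a ↦ Ideal.ResidueField.map_algebraMap _ _ _ _ a)

lemma mulMap_pull (f : K →+* L) (x : XDot L) (a : 𝓞 K) :
    (pull f x).mulMap a = x.mulMap (RingOfIntegers.mapRingHom f a) := by
  rw [← intHom_teich, intHom_pull, RingHom.comp_apply, WRat.mapHom_teich, intHom_teich]

lemma pull_surjective (f : K →+* L) : Function.Surjective (pull f) := by
  let _ : Algebra K L := f.toAlgebra
  rintro ⟨p, P⟩
  obtain ⟨q, rfl⟩ : ∃ q, PrimeSpectrum.comap (RingOfIntegers.mapRingHom f) q = p :=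
    Algebra.IsIntegral.comap_surjective (𝓞 K) (𝓞 L) p
  obtain ⟨Q, hQ⟩ := WRat.exists_comp_mapHom_eq (isIntegral_residueFieldMap
    (RingOfIntegers.extension_algebra_isIntegral K L).1 _ q.asIdeal rfl) P
  exact ⟨⟨q, Q⟩, congrArg (XDot.mk _) hQ⟩

end XDot

section Invariant

lemma finite_orbit_of_isIntegral (G : Type*) {A B : Type*} [Group G] [CommRing A] [CommRing B]
    [IsDomain B] [Algebra A B] [MulSemiringAction G B] [SMulCommClass G A B] {b : B}
    (hb : IsIntegral A b) : (MulAction.orbit G b).Finite := by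
  refine ((minpoly A b).rootSet_finite B).subset ?_
  rintro _ ⟨g, rfl⟩
  refine mem_rootSet'.mpr ⟨((minpoly.monic hb).map _).ne_zero, ?_⟩
  refine (aeval_algHom_apply (MulSemiringAction.toAlgHom A B g) b _).trans ?_
  rw [minpoly.aeval, map_zero]

lemma prod_orbit_mem_lifts (A : Type*) {B G : Type*} [CommRing A] [CommRing B] [Algebra A B]
    [Group G] [MulSemiringAction G B] [Algebra.IsInvariant A B G] {b : B}
    (hb : (MulAction.orbit G b).Finite) :
    (hb.toFinset.val.map fun c ↦ X - C c).prod ∈ lifts (algebraMap A B) := by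
  refine (lifts_iff_coeff_lifts _).mpr fun n ↦ Algebra.IsInvariant.isInvariant (G := G) _ fun g ↦ ?_
  have hg : g • ∏ c ∈ hb.toFinset, (X - C c) = ∏ c ∈ hb.toFinset, (X - C c) := by
    rw [Finset.smul_prod']
    refine Finset.prod_equiv (MulAction.toPerm g) (fun c ↦ ?_) fun c _ ↦ ?_
    · rw [hb.mem_toFinset, hb.mem_toFinset, MulAction.toPerm_apply, ← MulAction.orbit_eq_iff,
        ← MulAction.orbit_eq_iff, MulAction.orbit_smul]
    · rw [smul_sub, smul_X, smul_C, MulAction.toPerm_apply]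
  exact (coeff_smul ..).symm.trans (congrArg (coeff · n) hg)

lemma WRat.exists_smul_teich_eq {A B G D : Type*} [CommRing A] [CommRing B] [Algebra A B]
    [Group G] [MulSemiringAction G B] [Algebra.IsInvariant A B G] [CommRing D] [IsDomain D]
    {P Q : WRat B →+* D}
    (hPQ : P.comp (mapHom (algebraMap A B)) = Q.comp (mapHom (algebraMap A B))) {b : B}
    (hb : (MulAction.orbit G b).Finite) : ∃ g : G, Q (teich B b) = P (teich B (g • b)) := by
  have h := map_teich_eq_map_teich (prod_orbit_mem_lifts A hb) hPQ
  have hmem : Q (teich B b) ∈ hb.toFinset.val.map fun c ↦ P (teich B c) :=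
    h ▸ Multiset.mem_map_of_mem _ (hb.mem_toFinset.mpr (MulAction.mem_orbit_self b))
  obtain ⟨_, hc, hcb⟩ := Multiset.mem_map.mp hmem
  obtain ⟨g, rfl⟩ := hb.mem_toFinset.mp hc
  exact ⟨g, hcb.symm⟩

end Invariant

section Galois

variable {K L : Type*} [Field K] [Field L] [Algebra K L] [IsGalois K L]

instance smulCommClass_ringOfIntegers (K L : Type*) [Field K] [Field L] [Algebra K L] :
    SMulCommClass Gal(L/K) (𝓞 K) (𝓞 L) where
  smul_comm σ a b := by
    rw [Algebra.smul_def, Algebra.smul_def, smul_mul']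
    congr 1
    exact RingOfIntegers.ext (σ.commutes a)

instance isInvariant_ringOfIntegers : Algebra.IsInvariant (𝓞 K) (𝓞 L) Gal(L/K) where
  isInvariant b hb := by
    obtain ⟨a, ha⟩ := (InfiniteGalois.mem_range_algebraMap_iff_fixed (b : L)).mpr fun σ ↦
      congrArg (algebraMap (𝓞 L) L) (hb σ)
    have haint : IsIntegral ℤ a := (isIntegral_algebraMap_iff (algebraMap K L).injective).mp
      (ha ▸ b.isIntegral_coe)
    exact ⟨⟨a, haint⟩, RingOfIntegers.ext ha⟩

lemma isLocallyConstant_smul_ringOfIntegers (b : 𝓞 L) :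
    IsLocallyConstant fun σ : Gal(L/K) ↦ σ • b := by
  refine (IsLocallyConstant.iff_eventually_eq _).mpr fun σ ↦ ?_
  have hstab := (stabilizer_isOpen_of_isIntegral (K := K) (b : L)).leftCoset σ
  refine Filter.mem_of_superset (hstab.mem_nhds ⟨1, Subgroup.one_mem _, mul_one σ⟩) ?_
  rintro _ ⟨τ, hτ, rfl⟩
  have hτb : τ • b = b := RingOfIntegers.ext hτ
  exact (mul_smul σ τ b).trans (congrArg (σ • ·) hτb)

namespace XDot

variable {x y : XDot L}

lemma exists_mulMap_smul_eq (h : x.pull (algebraMap K L) = y.pull (algebraMap K L)) (b : 𝓞 L) :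
    ∃ σ : Gal(L/K), y.mulMap b = x.mulMap (σ • b) := by
  have h' := congrArg intHom h
  rw [intHom_pull, intHom_pull] at h'
  simpa only [intHom_teich] using WRat.exists_smul_teich_eq (A := 𝓞 K) h'
    (finite_orbit_of_isIntegral Gal(L/K) (Algebra.IsIntegral.isIntegral (R := 𝓞 K) b))

lemma exists_forall_mulMap_smul_eq (h : x.pull (algebraMap K L) = y.pull (algebraMap K L))
    {ι : Type*} [Nonempty ι] {f : ι → 𝓞 L} (hf : Directed (fun a b ↦ a ∈ Submonoid.powers b) f) :
    ∃ σ : Gal(L/K), ∀ i, y.mulMap (f i) = x.mulMap (σ • f i) := by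
  let T (b : 𝓞 L) : Set Gal(L/K) := {σ | x.mulMap (σ • b) = y.mulMap b}
  have hclosed (i : ι) : IsClosed (T (f i)) :=
    ((isLocallyConstant_smul_ringOfIntegers (f i)).comp x.mulMap).isClosed_fiber _
  have hanti {b c : 𝓞 L} (hbc : b ∈ Submonoid.powers c) : T c ⊆ T b := by
    rintro σ (hσ : x.mulMap (σ • c) = y.mulMap c)
    obtain ⟨n, rfl⟩ := hbc
    change x.mulMap (σ • c ^ n) = y.mulMap (c ^ n)
    rw [smul_pow', map_pow, map_pow, hσ]
  obtain ⟨σ, hσ⟩ := IsCompact.nonempty_iInter_of_directed_nonempty_isCompact_isClosed (T ∘ f)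
    (fun i j ↦ (hf i j).imp fun _ hk ↦ ⟨hanti hk.1, hanti hk.2⟩)
    (fun i ↦ (exists_mulMap_smul_eq h (f i)).imp fun _ ↦ Eq.symm)
    (fun i ↦ (hclosed i).isCompact) hclosed
  exact ⟨σ, fun i ↦ (Set.mem_iInter.mp hσ i).symm⟩

end XDot

end Galois

lemma directed_intEmb : Directed (fun a b ↦ a ∈ Submonoid.powers b) intEmb := by
  have hpow {ζ ξ : MuInf} (h : ζ ∈ Submonoid.powers ξ) :
      intEmb ζ ∈ Submonoid.powers (intEmb ξ) := by
    obtain ⟨i, rfl⟩ := h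
    exact ⟨i, (map_pow intEmb ξ i).symm⟩
  have hne (ζ : MuInf) : orderOf ζ ≠ 0 := (Submonoid.isOfFinOrder_coe.mp ζ.2).orderOf_pos.ne'
  intro ζ ξ
  obtain ⟨w, -, hw⟩ := exists_primitive (orderOf ζ * orderOf ξ) (mul_ne_zero (hne ζ) (hne ξ))
  obtain ⟨i, -, hi⟩ := hw ζ (by rw [pow_mul, pow_orderOf_eq_one, one_pow])
  obtain ⟨j, -, hj⟩ := hw ξ (by rw [mul_comm, pow_mul, pow_orderOf_eq_one, one_pow])
  exact ⟨w, hpow ⟨i, hi⟩, hpow ⟨j, hj⟩⟩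

lemma XDot.char_apply (x : XDot Qab) (ζ : MuInf) :
    (((x.char (.ofMul ζ)).toMul : ℂˣ) : ℂ) = x.mulMap (intEmb ζ) := rfl

lemma intEmb_galChar (σ : Gal(Qab/ℚ)) (ζ : MuInf) :
    intEmb (galChar σ (.ofMul ζ)).toMul =
      RingOfIntegers.mapRingHom (σ : Qab →+* Qab) (intEmb ζ) :=
  intEmb_injective (toComplex_intEmb _)

namespace XDot

lemma char_mul_galChar_apply (σ : Gal(Qab/ℚ)) (x : XDot Qab) (ζ : MuInf) :
    ((((x.char * galChar σ) (.ofMul ζ)).toMul : ℂˣ) : ℂ) =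
      x.mulMap (RingOfIntegers.mapRingHom (σ : Qab →+* Qab) (intEmb ζ)) := by
  rw [← intEmb_galChar]
  rfl

lemma psi_eq_of_char_eq {x y : XDot Qab} {σ : Gal(Qab/ℚ)} (h : y.char = x.char * galChar σ) :
    y.psi = x.psi * (cycl σ : ZHat) :=
  (congrArg HDot.toZHat h).trans (map_mul HDot.toZHat x.char (galChar σ))

lemma psi_pull (σ : Gal(Qab/ℚ)) (x : XDot Qab) :
    (x.pull (σ : Qab →+* Qab)).psi = x.psi * (cycl σ : ZHat) :=
  psi_eq_of_char_eq <| HDot.ext_complex fun ζ ↦ by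
    rw [char_mul_galChar_apply, char_apply, mulMap_pull]

lemma exists_psi_eq_of_pull_eq {F : IntermediateField ℚ Qab} {x y : XDot Qab}
    (h : x.pull (algebraMap F Qab) = y.pull (algebraMap F Qab)) :
    ∃ σ ∈ F.fixingSubgroup, y.psi = x.psi * (cycl σ : ZHat) := by
  have : IsGalois ℚ Qab := {}
  have : IsGalois F Qab := IsGalois.tower_top_of_isGalois ℚ F Qab
  obtain ⟨σ, hσ⟩ := exists_forall_mulMap_smul_eq h directed_intEmb
  let τ := F.fixingSubgroupEquiv.symm σ
  refine ⟨τ, τ.2, psi_eq_of_char_eq <| HDot.ext_complex fun ζ ↦ ?_⟩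
  rw [char_mul_galChar_apply, char_apply, hσ ζ]
  rfl

end XDot

section Continuity

variable {X Y : Type*} [TopologicalSpace X]

lemma isLocallyConstant_of_continuous_of_finite [TopologicalSpace Y] [T1Space Y] {f : X → Y}
    (hf : Continuous f) {s : Set Y} (hs : s.Finite) (hfs : ∀ x, f x ∈ s) : IsLocallyConstant f := by
  have : DiscreteTopology s := hs.isDiscrete.to_subtype
  exact (IsLocallyConstant.iff_continuous _).mpr (hf.subtype_mk hfs) |>.comp Subtype.val

lemma continuous_of_isLocallyConstant_toZModPow {p : ℕ} [Fact p.Prime] {f : X → ℤ_[p]}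
    (hf : ∀ k, IsLocallyConstant fun x ↦ PadicInt.toZModPow k (f x)) : Continuous f := by
  refine Metric.continuous_iff'.mpr fun a ε hε ↦ ?_
  obtain ⟨k, hk⟩ := PadicInt.exists_pow_neg_lt p hε
  filter_upwards [(hf k).eventually_eq a] with x hx
  rw [dist_eq_norm]
  refine ((PadicInt.norm_le_pow_iff_mem_span_pow _ _).mpr ?_).trans_lt hk
  rw [← PadicInt.ker_toZModPow, RingHom.mem_ker, map_sub, hx, sub_self]

end Continuity

lemma expMod_eq_of_apply_eq {n : ℕ} (hn : n ≠ 0) {χ χ' : HDot} {w : MuInf}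
    (hgen : ∀ ζ : MuInf, ζ ^ n = 1 → ∃ i < n, w ^ i = ζ) (h : χ (.ofMul w) = χ' (.ofMul w)) :
    expMod n hn χ = expMod n hn χ' := by
  have : NeZero n := ⟨hn⟩
  refine (expModFun_eq n hn χ (expModFun n hn χ').val fun ζ hζ ↦ ?_).trans
    (ZMod.natCast_zmod_val _)
  rw [← expModFun_spec n hn χ' ζ hζ]
  obtain ⟨i, -, rfl⟩ := hgen ζ hζ
  rw [ofMul_pow, map_nsmul χ, map_nsmul χ', h]

lemma HDot.toZModPow_toZHat (χ : HDot) (p : Nat.Primes) (k : ℕ) :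
    PadicInt.toZModPow k (χ.toZHat p) = expMod ((p : ℕ) ^ k) (pow_ne_zero k p.2.ne_zero) χ :=
  RingHom.congr_fun (PadicInt.lift_spec
    (f := fun k ↦ expMod ((p : ℕ) ^ k) (pow_ne_zero k p.2.ne_zero))
    (fun _ _ h ↦ expMod_compat _ _ _ _ (pow_dvd_pow (p : ℕ) h)) k) χ

namespace XDot

lemma continuous_mulMap {K : Type*} [Field K] [Algebra K Qbar] (a : 𝓞 K) :
    Continuous fun x : XDot K ↦ x.mulMap a := by
  refine continuous_coinduced_dom.mpr ?_
  let _ := pointwiseTopology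
  have h : Continuous fun x : XDot Qbar ↦
      x.mulMap (RingOfIntegers.mapRingHom (algebraMap K Qbar) a) :=
    (continuous_apply _).comp continuous_induced_dom
  exact h.congr fun x ↦ (mulMap_pull _ x a).symm

lemma isLocallyConstant_mulMap_of_pow_eq_one {K : Type*} [Field K] [Algebra K Qbar] {a : 𝓞 K}
    {n : ℕ} (hn : 0 < n) (ha : a ^ n = 1) : IsLocallyConstant fun x : XDot K ↦ x.mulMap a := by
  refine isLocallyConstant_of_continuous_of_finite (continuous_mulMap a)
    (nthRootsFinset n (1 : ℂ)).finite_toSet fun x ↦ (mem_nthRootsFinset hn 1).mpr ?_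
  rw [← map_pow, ha, map_one]

lemma continuous_psi : Continuous (psi : XDot Qab → ZHat) := by
  refine continuous_pi fun p ↦ continuous_of_isLocallyConstant_toZModPow fun k ↦ ?_
  have hn : (p : ℕ) ^ k ≠ 0 := pow_ne_zero k p.2.ne_zero
  obtain ⟨w, hw, hgen⟩ := exists_primitive _ hn
  have hloc := isLocallyConstant_mulMap_of_pow_eq_one (Nat.pos_of_ne_zero hn)
    ((map_pow intEmb w _).symm.trans (hw.pow_eq_one ▸ map_one intEmb))
  refine (IsLocallyConstant.iff_eventually_eq _).mpr fun x₀ ↦ ?_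
  filter_upwards [hloc.eventually_eq x₀] with x hx
  rw [psi, psi, HDot.toZModPow_toZHat, HDot.toZModPow_toZHat]
  exact expMod_eq_of_apply_eq hn hgen (Additive.toMul.injective (Subtype.ext (Units.ext hx)))

end XDot

lemma ZHat.continuous_toFinAdele : Continuous ZHat.toFinAdele := by
  have h : Continuous fun (a : ZHat) (v : HeightOneSpectrum (𝓞 ℚ)) ↦
      (Rat.HeightOneSpectrum.adicCompletionIntegers.padicIntEquiv v).symm
        (a (Rat.HeightOneSpectrum.primesEquiv v)) :=
    continuous_pi fun v ↦
      (Rat.HeightOneSpectrum.adicCompletionIntegers.padicIntEquiv v).symm.continuous.comp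
        (continuous_apply _)
  exact (RestrictedProduct.isEmbedding_structureMap
    (R := fun v : HeightOneSpectrum (𝓞 ℚ) ↦ v.adicCompletion ℚ)
    (A := fun v ↦ (v.adicCompletionIntegers ℚ : Set (v.adicCompletion ℚ)))
    (𝓕 := Filter.cofinite)).continuous.comp h

lemma XCheck.continuous_psi : Continuous XCheck.psi :=
  continuous_coinduced_dom.mpr <| continuous_sigma fun n ↦
    (continuous_const_mul (algebraMap ℚ FinAdele ((n : ℚ)⁻¹))).comp
      (ZHat.continuous_toFinAdele.comp XDot.continuous_psi)

lemma continuous_Psi : Continuous Psi := by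
  have hinv : Continuous fun x : XCheck Qab × PosReal ↦ (x.2 : ℝ)⁻¹ :=
    (continuous_subtype_val.comp continuous_snd).inv₀ fun x ↦ x.2.2.ne'
  have h : Continuous fun x : XCheck Qab × PosReal ↦ ((x.1.psi, (x.2 : ℝ)⁻¹) : Adele) :=
    (XCheck.continuous_psi.comp continuous_fst).prodMk hinv
  exact continuous_coinduced_dom.mpr (continuous_coinduced_rng.comp h)

section QuotientMaps

lemma isQuotientMap_sigmaMap_id {ι : Type*} {X Y : ι → Type*} [∀ i, TopologicalSpace (X i)]
    [∀ i, TopologicalSpace (Y i)] {f : ∀ i, X i → Y i} (hf : ∀ i, IsQuotientMap (f i)) :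
    IsQuotientMap (Sigma.map id f) where
  isCoinducing := .of_isOpen_preimage_iff_isOpen fun s ↦ by
    rw [isOpen_sigma_iff, isOpen_sigma_iff]
    exact forall_congr' fun i ↦ (hf i).isOpen_preimage (s := Sigma.mk i ⁻¹' s)
  surjective := Function.surjective_id.sigma_map fun i ↦ (hf i).surjective

lemma isQuotientMap_prodMap_id {X Y Z : Type*} [TopologicalSpace X] [TopologicalSpace Y]
    [TopologicalSpace Z] [LocallyCompactSpace Z] {f : X → Y} (hf : IsQuotientMap f) :
    IsQuotientMap (Prod.map f id : X × Z → Y × Z) where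
  isCoinducing := .of_isOpen_preimage_iff_isOpen fun s ↦ by
    refine ⟨fun hs ↦ ?_, fun hs ↦ hs.preimage (hf.continuous.prodMap continuous_id)⟩
    exact isOpen_iff_continuous_mem.mpr
      (hf.continuous_lift_prod_left (isOpen_iff_continuous_mem.mp hs))
  surjective := hf.surjective.prodMap Function.surjective_id

variable (K L : Type*) [Field K] [Field L] [Algebra K L] [Algebra K Qbar] [Algebra L Qbar]
  [IsScalarTower K L Qbar]

lemma XDot.isQuotientMap_pull :
    IsQuotientMap (XDot.pull (algebraMap K L) : XDot L → XDot K) where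
  eq_coinduced := by
    have h : (XDot.pull (algebraMap K Qbar) : XDot Qbar → XDot K) =
        XDot.pull (algebraMap K L) ∘ XDot.pull (algebraMap L Qbar) :=
      funext fun x ↦ by rw [Function.comp_apply, XDot.pull_pull, ← IsScalarTower.algebraMap_eq]
    exact (congrArg (fun f ↦ TopologicalSpace.coinduced f XDot.pointwiseTopology) h).trans
      (@coinduced_compose _ _ _ XDot.pointwiseTopology _ _).symm
  surjective := XDot.pull_surjective _

lemma XCheck.isQuotientMap_pull :
    IsQuotientMap (XCheck.pull (algebraMap K L) : XCheck L → XCheck K) :=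
  .of_comp_isQuotientMap (f := Quotient.mk (XCheck.setoid L)) isQuotientMap_quot_mk
    (isQuotientMap_quot_mk.comp (isQuotientMap_sigmaMap_id fun _ ↦ XDot.isQuotientMap_pull K L))

lemma XFrak.isQuotientMap_proj : IsQuotientMap (XFrak.proj K L) := by
  have : LocallyCompactSpace PosReal := (isOpen_Ioi (a := (0 : ℝ))).locallyCompactSpace
  exact .of_comp_isQuotientMap (f := Quot.mk _) isQuotientMap_quot_mk
    (isQuotientMap_quot_mk.comp (isQuotientMap_prodMap_id (XCheck.isQuotientMap_pull K L)))

end QuotientMaps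

section Descent

variable {K L : Type*} [Field K] [Field L] (f : K →+* L)

namespace XCheck

lemma mk_mul_frob (n a : ℕ+) (x : XDot K) : mk (n * a) (x.frob a) = mk n x :=
  Quotient.sound ⟨1, a, mul_one _, by rw [XDot.frob_frob, mul_one]⟩

variable {f} in
lemma exists_mk_eq_of_pull_eq {x y : XCheck L} (h : x.pull f = y.pull f) :
    ∃ (n : ℕ+) (x' y' : XDot L), mk n x' = x ∧ mk n y' = y ∧ x'.pull f = y'.pull f := by
  induction x using Quotient.inductionOn with | h x => ?_
  induction y using Quotient.inductionOn with | h y => ?_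
  obtain ⟨a, b, hn, hxy⟩ := Quotient.exact h
  refine ⟨x.1 * a, x.2.frob a, y.2.frob b, mk_mul_frob _ _ _, ?_, ?_⟩
  · exact (congrArg (mk · (y.2.frob b)) hn).trans (mk_mul_frob _ _ _)
  · rw [XDot.pull_frob, XDot.pull_frob]
    exact hxy

lemma pull_surjective : Function.Surjective (pull f) := by
  intro y
  induction y using Quotient.inductionOn with | h y => ?_
  obtain ⟨x, hx⟩ := XDot.pull_surjective f y.2
  exact ⟨mk y.1 x, congrArg (mk y.1) hx⟩

end XCheck

namespace XFrak

lemma mk_frob (q : PosRat) (x : XCheck K) (u : PosReal) :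
    mk (x.frob q) (q.toReal⁻¹ * u) = mk x u :=
  (Quot.sound ⟨q, rfl⟩).symm

variable {f} in
lemma factorsThrough_pull {α : Type*} {g : XFrak L → α}
    (hg : ∀ x y, x.pull f = y.pull f → ∀ u, g (mk x u) = g (mk y u)) :
    g.FactorsThrough (pull f) := by
  suffices h : ∀ a b, Relation.EqvGen
      (fun a b : XCheck K × PosReal ↦ ∃ q : PosRat, b = (a.1.frob q, q.toReal⁻¹ * a.2)) a b →
      ∀ x y, x.pull f = a.1 → y.pull f = b.1 → g (mk x a.2) = g (mk y b.2) by
    intro x y hxy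
    induction x using Quot.inductionOn with | h x => ?_
    induction y using Quot.inductionOn with | h y => ?_
    exact h _ _ (Quot.eqvGen_exact hxy) x.1 y.1 rfl rfl
  intro a b h
  induction h with
  | rel a _ h =>
    rintro x y hx hy
    obtain ⟨q, rfl⟩ := h
    rw [← mk_frob q x]
    exact hg _ _ (by rw [XCheck.pull_frob, hx, hy]) _
  | refl a => exact fun x y hx hy ↦ hg x y (hx.trans hy.symm) a.2
  | symm _ _ _ ih => exact fun x y hx hy ↦ (ih y x hy hx).symm
  | trans _ b _ _ _ ih₁ ih₂ =>
    intro x y hx hy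
    obtain ⟨z, hz⟩ := XCheck.pull_surjective f b.1
    exact (ih₁ x z hx hz).trans (ih₂ z y hz hy)

end XFrak

end Descent

namespace XCheck

lemma psi_pull (σ : Gal(Qab/ℚ)) (x : XCheck Qab) :
    (x.pull (σ : Qab →+* Qab)).psi = x.psi * ZHat.toFinAdele (cycl σ) := by
  induction x using Quotient.inductionOn with | h x => ?_
  change algebraMap ℚ FinAdele ((x.1 : ℚ)⁻¹) * ZHat.toFinAdele (x.2.pull (σ : Qab →+* Qab)).psi =
    algebraMap ℚ FinAdele ((x.1 : ℚ)⁻¹) * ZHat.toFinAdele x.2.psi * ZHat.toFinAdele (cycl σ)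
  rw [XDot.psi_pull, map_mul, mul_assoc]

lemma exists_psi_eq_of_pull_eq {F : IntermediateField ℚ Qab} {x y : XCheck Qab}
    (h : x.pull (algebraMap F Qab) = y.pull (algebraMap F Qab)) :
    ∃ σ ∈ F.fixingSubgroup, y.psi = x.psi * ZHat.toFinAdele (cycl σ) := by
  obtain ⟨n, x, y, rfl, rfl, hxy⟩ := exists_mk_eq_of_pull_eq h
  obtain ⟨σ, hσ, e⟩ := XDot.exists_psi_eq_of_pull_eq hxy
  refine ⟨σ, hσ, ?_⟩
  change algebraMap ℚ FinAdele ((n : ℚ)⁻¹) * ZHat.toFinAdele y.psi =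
    algebraMap ℚ FinAdele ((n : ℚ)⁻¹) * ZHat.toFinAdele x.psi * ZHat.toFinAdele (cycl σ)
  rw [e, map_mul, mul_assoc]

end XCheck

lemma Psi_mk (x : XCheck Qab) (u : PosReal) :
    Psi (XFrak.mk x u) = AdelicSpace.mk (x.psi, ((u⁻¹ : PosReal) : ℝ)) := rfl

lemma Psi_flow (t : PosReal) (x : XFrak Qab) :
    Psi (XFrak.flow t x) = AdelicSpace.flow t⁻¹ (Psi x) := by
  induction x using Quot.inductionOn with | h x => ?_
  refine congrArg AdelicSpace.mk (Prod.ext (mul_one _).symm ?_)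
  exact congrArg Subtype.val (mul_inv_rev t x.2)

lemma Psi_galAct (σ : Gal(Qab/ℚ)) (x : XFrak Qab) :
    Psi (XFrak.galAct σ x) = AdeleClassSpace.galAct σ (Psi x) := by
  induction x using Quot.inductionOn with
  | h x => exact congrArg AdelicSpace.mk (Prod.ext (XCheck.psi_pull σ x.1) (mul_one _).symm)

namespace XFrak

lemma proj_flow {K L : Type*} [Field K] [Field L] [Algebra K L] (t : PosReal) (x : XFrak L) :
    proj K L (flow t x) = flow t (proj K L x) := by
  induction x using Quot.inductionOn with
  | h x => rfl

lemma pull_pull {K L M : Type*} [Field K] [Field L] [Field M] (f : K →+* L) (g : L →+* M)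
    (x : XFrak M) : pull f (pull g x) = pull (g.comp f) x := by
  induction x using Quot.inductionOn with | h x => ?_
  obtain ⟨x, u⟩ := x
  induction x using Quotient.inductionOn with
  | h x => exact congrArg (fun z ↦ mk (XCheck.mk x.1 z) u) (XDot.pull_pull f g x.2)

lemma proj_galAct {F : IntermediateField ℚ Qab} (g : Gal(F/ℚ)) (x : XFrak Qab) :
    proj F Qab (galAct (g.liftNormal Qab) x) = galAct g (proj F Qab x) := by
  have hcomp : ((g.liftNormal Qab : Gal(Qab/ℚ)) : Qab →+* Qab).comp (algebraMap F Qab) =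
      (algebraMap F Qab).comp (g : F →+* F) := RingHom.ext (g.liftNormal_commutes Qab)
  exact (pull_pull _ _ x).trans (hcomp ▸ (pull_pull _ _ x).symm)

end XFrak

namespace CCSpace

variable {F : IntermediateField ℚ Qab}

lemma continuous_proj (F : IntermediateField ℚ Qab) : Continuous (proj F) :=
  continuous_coinduced_dom.mpr continuous_coinduced_rng

lemma proj_galAct (g : Gal(F/ℚ)) (a : AdeleClassSpace) :
    proj F (AdeleClassSpace.galAct (g.liftNormal Qab) a) = galAct g (proj F a) := by
  induction a using Quot.inductionOn with
  | h a => rfl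

lemma proj_flow (t : PosReal) (a : AdeleClassSpace) :
    proj F (AdelicSpace.flow t a) = AdelicSpace.flow t (proj F a) := by
  induction a using Quot.inductionOn with
  | h a => rfl

end CCSpace

lemma AdelicSpace.mk_mul_toFinAdele {U : Subgroup ZHatˣ} {z : ZHatˣ} (hz : z ∈ U) (a : FinAdele)
    (r : ℝ) : (mk (a * ZHat.toFinAdele z, r) : AdelicSpace U) = mk (a, r) :=
  (Quot.sound ⟨1, z, hz, by rw [Units.val_one, map_one, one_mul, Prod.mk_mul_mk, mul_one]⟩).symm

lemma proj_Psi_factorsThrough (F : IntermediateField ℚ Qab) :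
    (CCSpace.proj F ∘ Psi).FactorsThrough (XFrak.proj F Qab) :=
  XFrak.factorsThrough_pull fun x y h u ↦ by
    obtain ⟨σ, hσ, e⟩ := XCheck.exists_psi_eq_of_pull_eq h
    rw [Function.comp_apply, Function.comp_apply, Psi_mk, Psi_mk, e]
    exact (AdelicSpace.mk_mul_toFinAdele (Subgroup.mem_map_of_mem _ hσ) _ _).symm

/-- The map `Ψ_F : 𝔛_F → 𝒳_F`, the descent of `φ_{ℚ^ab/F} ∘ Ψ_{ℚ^ab}` along `ϖ_{ℚ^ab/F}`. It is
encoded by a choice of preimages, on which it does not depend by `proj_Psi_factorsThrough`. -/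
def PsiSub (F : IntermediateField ℚ Qab) (y : XFrak F) : CCSpace F :=
  CCSpace.proj F (Psi (Function.surjInv (XFrak.isQuotientMap_proj F Qab).surjective y))

section PsiSub

variable {F : IntermediateField ℚ Qab}

lemma PsiSub_proj (x : XFrak Qab) : PsiSub F (XFrak.proj F Qab x) = CCSpace.proj F (Psi x) :=
  proj_Psi_factorsThrough F (Function.surjInv_eq _ _)

lemma continuous_PsiSub : Continuous (PsiSub F) :=
  (XFrak.isQuotientMap_proj F Qab).continuous_iff.mpr <|
    ((CCSpace.continuous_proj F).comp continuous_Psi).congr fun x ↦ (PsiSub_proj x).symm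

lemma PsiSub_flow (t : PosReal) (y : XFrak F) :
    PsiSub F (XFrak.flow t y) = AdelicSpace.flow t⁻¹ (PsiSub F y) := by
  obtain ⟨x, rfl⟩ := (XFrak.isQuotientMap_proj F Qab).surjective y
  rw [← XFrak.proj_flow, PsiSub_proj, PsiSub_proj, Psi_flow, CCSpace.proj_flow]

lemma PsiSub_galAct (g : Gal(F/ℚ)) (y : XFrak F) :
    PsiSub F (XFrak.galAct g y) = CCSpace.galAct g (PsiSub F y) := by
  obtain ⟨x, rfl⟩ := (XFrak.isQuotientMap_proj F Qab).surjective y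
  rw [← XFrak.proj_galAct, PsiSub_proj, PsiSub_proj, Psi_galAct, CCSpace.proj_galAct]

end PsiSub

end

theorem lemma3p5_general :
    Continuous Psi ∧
    (∀ (t : PosReal) (x : XFrak Qab), Psi (XFrak.flow t x) = AdelicSpace.flow t⁻¹ (Psi x)) ∧
    (∀ (σ : Gal(Qab/ℚ)) (x : XFrak Qab),
      Psi (XFrak.galAct σ x) = AdeleClassSpace.galAct σ (Psi x)) ∧
    ∀ F : IntermediateField ℚ Qab,
      ∃ PsiF : XFrak F → CCSpace F,
        (∀ x : XFrak Qab, PsiF (XFrak.proj F Qab x) = CCSpace.proj F (Psi x)) ∧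
        (∀ Psi' : XFrak F → CCSpace F,
          (∀ x : XFrak Qab, Psi' (XFrak.proj F Qab x) = CCSpace.proj F (Psi x)) → Psi' = PsiF) ∧
        Continuous PsiF ∧
        (∀ (t : PosReal) (y : XFrak F), PsiF (XFrak.flow t y) = AdelicSpace.flow t⁻¹ (PsiF y)) ∧
        (∀ (g : Gal(F/ℚ)) (y : XFrak F),
          PsiF (XFrak.galAct g y) = CCSpace.galAct g (PsiF y)) := by
  refine ⟨continuous_Psi, Psi_flow, Psi_galAct, fun F ↦ ⟨PsiSub F, PsiSub_proj, fun Psi' h ↦ ?_,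
    continuous_PsiSub, PsiSub_flow, PsiSub_galAct⟩⟩
  exact (XFrak.isQuotientMap_proj F Qab).surjective.injective_comp_right
    (funext fun x ↦ (h x).trans (PsiSub_proj x).symm)

theorem lemma3p5 :
    Continuous Psi ∧
    (∀ (t : PosReal) (x : XFrak Qab), Psi (XFrak.flow t x) = AdelicSpace.flow t⁻¹ (Psi x)) ∧
    (∀ (σ : Gal(Qab/ℚ)) (x : XFrak Qab),
      Psi (XFrak.galAct σ x) = AdeleClassSpace.galAct σ (Psi x)) ∧
    ∀ (F : IntermediateField ℚ Qab) [FiniteDimensional ℚ F],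
      ∃ PsiF : XFrak F → CCSpace F,
        (∀ x : XFrak Qab, PsiF (XFrak.proj F Qab x) = CCSpace.proj F (Psi x)) ∧
        (∀ Psi' : XFrak F → CCSpace F,
          (∀ x : XFrak Qab, Psi' (XFrak.proj F Qab x) = CCSpace.proj F (Psi x)) → Psi' = PsiF) ∧
        Continuous PsiF ∧
        (∀ (t : PosReal) (y : XFrak F), PsiF (XFrak.flow t y) = AdelicSpace.flow t⁻¹ (PsiF y)) ∧
        (∀ (g : Gal(F/ℚ)) (y : XFrak F),
          PsiF (XFrak.galAct g y) = CCSpace.galAct g (PsiF y)) := by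
  obtain ⟨hcont, hflow, hgal, hF⟩ := lemma3p5_general
  exact ⟨hcont, hflow, hgal, fun F _ ↦ hF F⟩
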